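/- Let $\mathcal M$ be a closed (compact, without boundary) Riemannian spin manifold of dimension $4$ with spinor bundle $S=S_r\oplus S_l$, Dirac matrices $\gamma^\mu$ and Dirac operator $\slashed\partial=-i\gamma^\mu(\partial_\mu+\omega_\mu)$, where $\omega_\mu$ is the spin connection. Let $\mathcal A_{SM}=\mathbb C\oplus\mathbb H\oplus M_3(\mathbb C)$ and $\mathcal A=C^\infty(\mathcal M)\otimes\mathcal A_{SM}\otimes\mathbb C^2$, whose elements are written $a=(c,c',q,q',m,m')$, and let $\rho(c,c',q,q',m,m')=(c',c,q',q,m',m)$. The algebra acts on $L^2(\mathcal M,S)\otimes\mathbb C^{32}$, where $\mathbb C^{32}=\mathbb C^2\otimes\mathbb C^4\otimes\mathbb C^4$ carries the indices $C$ (particle/antiparticle), $I=0,1,2,3$ (lepto-colour) and $\alpha=\dot1,\dot2,1,2$ (flavour), as follows. On particles, $a$ acts on the index $\alpha$ by $\mathrm{diag}(c,\bar c,q')$ on $S_r$ and by $\mathrm{diag}(c',\bar c',q)$ on $S_l$. On antiparticles, it acts on the index $I$: on $S_r$ by $\mathrm{diag}(c,m)$ if $\alpha=\dot1,\dot2$ and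 by $\mathrm{diag}(c',m')$ if $\alpha=1,2$; on $S_l$ by $\mathrm{diag}(c',m')$ if $\alpha=\dot1,\dot2$ and by $\mathrm{diag}(c,m)$ if $\alpha=1,2$. It acts as the identity on all other indices, and quaternions act as $2\times2$ complex matrices. Put $\slashed D=\slashed\partial\otimes\mathbb I_{32}$ and $[\slashed D,b]_\rho=\slashed D\,b-\rho(b)\slashed D$. A free $1$-form is a finite sum $\slashed A=\sum_i a_i[\slashed D,b_i]_\rho$ with $a_i,b_i\in\mathcal A$. Fix non-zero real constants $g_1,g_2,g_3$. (1) Every free $1$-form is $\slashed A=-i\gamma^\mu A_\mu$ for a unique smooth $1$-form $A_\mu$ with values in $\mathcal A_{SM}\otimes\mathbb C^2$, written $A_\mu=(c^r_\mu,c^l_\mu,q^l_\mu,q^r_\mu,m^r_\mu,m^l_\mu)$. The form $\slashed A$ is called unimodular if $\mathrm{Tr}\,A_\mu=0$ in the above representation. (2) If $\slashed A$ is a selfadjoint free $1$-form, there are unique smooth $1$-forms $a_\mu,w_\mu,B_\mu,V^0_\mu$ (real), $g_\mu=g_\mu^\dagger$ ($M_3(\mathbb C)$-valued), $iW_\mu$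 ($\mathfrak{su}(2)$-valued) and $iV_\mu$ ($\mathfrak{su}(3)$-valued) with $$c^r_\mu=a_\mu-\tfrac{ig_1}{2}B_\mu,\quad q^r_\mu=w_\mu\mathbb I_2-\tfrac{ig_2}{2}W_\mu,\quad m^r_\mu=g_\mu+i\left(V^0_\mu\mathbb I_3+\tfrac{g_3}{2}V_\mu\right),$$ $$c^l_\mu=-a_\mu-\tfrac{ig_1}{2}B_\mu,\quad q^l_\mu=-w_\mu\mathbb I_2-\tfrac{ig_2}{2}W_\mu,\quad m^l_\mu=-g_\mu+i\left(V^0_\mu\mathbb I_3+\tfrac{g_3}{2}V_\mu\right).$$ Such a form is unimodular if and only if $V^0_\mu=\frac{g_1}{6}B_\mu$. (3) The unimodular selfadjoint free $1$-forms are parametrized, through these formulas with $V^0_\mu=\frac{g_1}{6}B_\mu$, by two real $1$-form fields $a_\mu,w_\mu$, a selfadjoint $M_3(\mathbb C)$-valued $1$-form field $g_\mu$, a $\mathfrak u(1)$-valued field $iB_\mu$ ($B_\mu$ real), an $\mathfrak{su}(2)$-valued field $iW_\mu$ and an $\mathfrak{su}(3)$-valued field $iV_\mu$: each unimodular selfadjoint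 free $1$-form arises from exactly one such collection of smooth fields, and each such collection arises from exactly one unimodular selfadjoint free $1$-form. -/

import Mathlib

open scoped Manifold ContDiff Matrix Quaternion Bundle
open MeasureTheory

/- Norms on spaces of complex matrices (needed to speak of smooth matrix-valued maps; all norms on
these finite dimensional spaces are equivalent). -/
open scoped Matrix.Norms.L2Operator

noncomputable section

namespace TwistedSM

/-! ### Dirac matrices in chiral representation -/

/-- Index set of the components of a Dirac spinor: `Sum.inl k` is the component `(s, ṡ) = (r, k)`
and `Sum.inr k` is the component `(s, ṡ) = (l, k)`. -/
abbrev SpinIdx := Fin 2 ⊕ Fin 2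

/-- The Pauli matrices. -/
def pauli : Fin 3 → Matrix (Fin 2) (Fin 2) ℂ :=
  ![!![0, 1; 1, 0], !![0, -Complex.I; Complex.I, 0], !![1, 0; 0, -1]]

/-- `σ^μ = {1, -iσ_j}`. -/
def sigma : Fin 4 → Matrix (Fin 2) (Fin 2) ℂ :=
  Fin.cons 1 fun j => (-Complex.I) • pauli j

/-- `σ̃^μ = {1, iσ_j}`. -/
def sigmaTilde : Fin 4 → Matrix (Fin 2) (Fin 2) ℂ :=
  Fin.cons 1 fun j => Complex.I • pauli j

/-- The euclidean Dirac matrices `γ_E^a`. -/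
def diracMatrix (a : Fin 4) : Matrix SpinIdx SpinIdx ℂ :=
  Matrix.fromBlocks 0 (sigma a) (sigmaTilde a) 0

/-! ### The finite algebra and its representation on the 128 components -/

/-- The algebra `A_SM = ℂ ⊕ ℍ ⊕ M₃(ℂ)`. -/
abbrev ASM := ℂ × ℍ[ℝ] × Matrix (Fin 3) (Fin 3) ℂ

/-- Twice the algebra `A_SM`; an element is written `((c, q, m), (c', q', m'))`. -/
abbrev DoubleASM := ASM × ASM

/-- The lepto-colour index `I = 0; 1, 2, 3`. -/
abbrev ColourIdx := Unit ⊕ Fin 3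

/-- The flavour index `α = 1̇, 2̇; 1, 2`: dotted values are `Sum.inl`, undotted ones `Sum.inr`. -/
abbrev FlavourIdx := Fin 2 ⊕ Fin 2

/-- The 32 internal indices `C I α`: particles (`C = 0`) are `Sum.inl`, antiparticles `Sum.inr`. -/
abbrev InternalIdx := (ColourIdx × FlavourIdx) ⊕ (ColourIdx × FlavourIdx)

/-- The 128 indices of `ℂ³² ⊗ S`. -/
abbrev FullIdx := InternalIdx × SpinIdx

/-- A quaternion as the `2 × 2` complex matrix `(α, β; -β̄, ᾱ)`. -/
def quatMatrix (q : ℍ[ℝ]) : Matrix (Fin 2) (Fin 2) ℂ :=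
  !![⟨q.re, q.imI⟩, ⟨q.imJ, q.imK⟩; ⟨-q.imJ, q.imK⟩, ⟨q.re, -q.imI⟩]

/-- `diag(c, c̄, q)` on the flavour index. -/
def flavourBlock (c : ℂ) (q : ℍ[ℝ]) : Matrix FlavourIdx FlavourIdx ℂ :=
  Matrix.fromBlocks (Matrix.diagonal ![c, star c]) 0 0 (quatMatrix q)

/-- `diag(c, m)` on the lepto-colour index. -/
def colourBlock (c : ℂ) (m : Matrix (Fin 3) (Fin 3) ℂ) : Matrix ColourIdx ColourIdx ℂ :=
  Matrix.fromBlocks (Matrix.diagonal fun _ => c) 0 0 m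

/-- The action of `((c, q, m), (c', q', m'))` on the right-handed spinor components: on particles it
is `Q_r = diag(c, c̄, q')` on the flavour index, on antiparticles `M_r`, which is `diag(c, m)` on the
lepto-colour index for dotted flavours and `diag(c', m')` for undotted flavours. -/
def repRight (a : DoubleASM) : Matrix InternalIdx InternalIdx ℂ :=
  Matrix.fromBlocks
    (Matrix.kroneckerMap (· * ·) 1 (flavourBlock a.1.1 a.2.2.1)) 0 0
    (Matrix.kroneckerMap (· * ·) (colourBlock a.1.1 a.1.2.2) (Matrix.fromBlocks 1 0 0 0) +
      Matrix.kroneckerMap (· * ·) (colourBlock a.2.1 a.2.2.2) (Matrix.fromBlocks 0 0 0 1))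

/-- The action on the left-handed spinor components, with `Q_l = diag(c', c̄', q)` and with `M_l`
equal to `diag(c', m')` for dotted flavours and to `diag(c, m)` for undotted flavours. -/
def repLeft (a : DoubleASM) : Matrix InternalIdx InternalIdx ℂ :=
  Matrix.fromBlocks
    (Matrix.kroneckerMap (· * ·) 1 (flavourBlock a.2.1 a.1.2.1)) 0 0
    (Matrix.kroneckerMap (· * ·) (colourBlock a.2.1 a.2.2.2) (Matrix.fromBlocks 1 0 0 0) +
      Matrix.kroneckerMap (· * ·) (colourBlock a.1.1 a.1.2.2) (Matrix.fromBlocks 0 0 0 1))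

/-- The representation of the doubled algebra on the 128 components: diagonal in the chirality
index `s` and trivial in the index `ṡ`. -/
def rep (a : DoubleASM) : Matrix FullIdx FullIdx ℂ :=
  Matrix.blockDiagonal (Sum.elim (fun _ => repRight a) (fun _ => repLeft a))

/-- A matrix on spinor indices, extended by the identity to all indices. -/
def spinAct (S : Matrix SpinIdx SpinIdx ℂ) : Matrix FullIdx FullIdx ℂ :=
  Matrix.kroneckerMap (· * ·) (1 : Matrix InternalIdx InternalIdx ℂ) S

/-! ### Riemannian spin 4-manifolds -/

/-- The model space of 4-manifolds. -/
abbrev E4 := EuclideanSpace ℝ (Fin 4)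

section Geometry

variable {M : Type*} [TopologicalSpace M] [ChartedSpace E4 M] [IsManifold (𝓡 4) ∞ M]

/-- Smooth Riemannian metrics on `M`. -/
abbrev Metric (M : Type*) [TopologicalSpace M] [ChartedSpace E4 M] [IsManifold (𝓡 4) ∞ M] :=
  Bundle.ContMDiffRiemannianMetric (𝓡 4) ∞ E4 (fun x : M => TangentSpace (𝓡 4) x)

/-- Smooth 1-forms on `M` with values in the vector space `V`. -/
abbrev OneForm (M : Type*) [TopologicalSpace M] [ChartedSpace E4 M] [IsManifold (𝓡 4) ∞ M]
    (V : Type*) [NormedAddCommGroup V] [NormedSpace ℝ V] :=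
  ContMDiffSection (𝓡 4) (E4 →L[ℝ] V) ∞
    (fun x : M => TangentSpace (𝓡 4) x →L[ℝ] Bundle.Trivial M V x)

/-- The Gram matrix at `y`, in the chart at `x₀`, of the coordinate vector fields. -/
def gram (g : Metric M) (x₀ : M) (y : E4) : Matrix (Fin 4) (Fin 4) ℝ :=
  let φ := extChartAt (𝓡 4) x₀
  let e : Fin 4 → TangentSpace (𝓡 4) (φ.symm y) := fun μ =>
    mfderiv 𝓘(ℝ, E4) (𝓡 4) φ.symm y (EuclideanSpace.single μ (1 : ℝ) : E4)
  Matrix.of fun μ ν => g.inner (φ.symm y) (e μ) (e ν)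

/-- The Riemannian volume of the domain of the chart at `x₀`, that is `√(det g_μν) d⁴y`. -/
def chartVolume [MeasurableSpace M] (g : Metric M) (x₀ : M) : Measure M :=
  (((volume : Measure E4).restrict (extChartAt (𝓡 4) x₀).target).withDensity
    fun y => ENNReal.ofReal (Real.sqrt (gram g x₀ y).det)).map (extChartAt (𝓡 4) x₀).symm

/-- A smooth partition of unity subordinate to the cover by chart domains. -/
def chartPartition (M : Type*) [TopologicalSpace M] [ChartedSpace E4 M] [IsManifold (𝓡 4) ∞ M]
    [CompactSpace M] [T2Space M] : SmoothPartitionOfUnity M (𝓡 4) M Set.univ :=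
  (SmoothPartitionOfUnity.exists_isSubordinate_chartAt_source (𝓡 4) M).choose

/-- The Riemannian volume measure, glued from the charts by a partition of unity. -/
def riemannianVolume [CompactSpace M] [T2Space M] [MeasurableSpace M] (g : Metric M) : Measure M :=
  Measure.sum fun x₀ : M =>
    (chartVolume g x₀).withDensity fun x => ENNReal.ofReal (chartPartition M x₀ x)

/-- Clifford multiplication by the tangent vector `v` at `x`, expressed in the local frame `e`. -/
def cliffordIn (g : Metric M) (e : Fin 4 → (x : M) → TangentSpace (𝓡 4) x) (x : M)
    (v : TangentSpace (𝓡 4) x) : Matrix SpinIdx SpinIdx ℂ :=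
  ∑ a, (g.inner x v (e a x) : ℂ) • diracMatrix a

/-- A spin structure on the Riemannian manifold `(M, g)`: an open cover with smooth orthonormal
frames (vierbeins) and a smooth cocycle with values in `Spin(4) = SU(2) × SU(2)` that lifts the
changes of frame. -/
structure SpinStructure (g : Metric M) where
  /-- The index set of the cover. -/
  Index : Type
  /-- The cover. -/
  U : Index → Set M
  isOpen_U : ∀ i, IsOpen (U i)
  exists_mem_U : ∀ x, ∃ i, x ∈ U i
  /-- The vierbein over `U i` (its values outside `U i` are irrelevant). -/
  frame : Index → Fin 4 → (x : M) → TangentSpace (𝓡 4) x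
  frame_smooth : ∀ i a, ContMDiffOn (𝓡 4) (𝓡 4).tangent ∞
    (fun x => (⟨x, frame i a x⟩ : TangentBundle (𝓡 4) M)) (U i)
  frame_orthonormal : ∀ i, ∀ x ∈ U i, ∀ a b,
    g.inner x (frame i a x) (frame i b x) = if a = b then 1 else 0
  /-- The transition function from index `j` to index `i` on right-handed spinors. -/
  liftR : Index → Index → M → Matrix (Fin 2) (Fin 2) ℂ
  /-- The transition function from index `j` to index `i` on left-handed spinors. -/
  liftL : Index → Index → M → Matrix (Fin 2) (Fin 2) ℂ
  liftR_smooth : ∀ i j,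
    ContMDiffOn (𝓡 4) 𝓘(ℝ, Matrix (Fin 2) (Fin 2) ℂ) ∞ (liftR i j) (U i ∩ U j)
  liftL_smooth : ∀ i j,
    ContMDiffOn (𝓡 4) 𝓘(ℝ, Matrix (Fin 2) (Fin 2) ℂ) ∞ (liftL i j) (U i ∩ U j)
  liftR_mem : ∀ i j, ∀ x ∈ U i ∩ U j, liftR i j x ∈ Matrix.specialUnitaryGroup (Fin 2) ℂ
  liftL_mem : ∀ i j, ∀ x ∈ U i ∩ U j, liftL i j x ∈ Matrix.specialUnitaryGroup (Fin 2) ℂ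
  liftR_cocycle : ∀ i j k, ∀ x ∈ U i ∩ U j ∩ U k, liftR i j x * liftR j k x = liftR i k x
  liftL_cocycle : ∀ i j k, ∀ x ∈ U i ∩ U j ∩ U k, liftL i j x * liftL j k x = liftL i k x
  lift_covers : ∀ i j, ∀ x ∈ U i ∩ U j, ∀ v : TangentSpace (𝓡 4) x,
    Matrix.fromBlocks (liftR i j x) 0 0 (liftL i j x) * cliffordIn g (frame j) x v =
      cliffordIn g (frame i) x v * Matrix.fromBlocks (liftR i j x) 0 0 (liftL i j x)

namespace SpinStructure

variable {g : Metric M} (σ : SpinStructure g)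

/-- The transition functions of the spinor bundle. -/
def lift (i j : σ.Index) (x : M) : Matrix SpinIdx SpinIdx ℂ :=
  Matrix.fromBlocks (σ.liftR i j x) 0 0 (σ.liftL i j x)

/-- `⟨[e_a, e_b], e_c⟩` for the vierbein over `U i`. -/
def structureFn (i : σ.Index) (x : M) (a b c : Fin 4) : ℝ :=
  g.inner x (VectorField.mlieBracket (𝓡 4) (σ.frame i a) (σ.frame i b) x) (σ.frame i c x)

/-- `⟨∇_{e_a} e_b, e_c⟩` for the Levi-Civita connection, by the Koszul formula in the orthonormal
vierbein over `U i`. -/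
def leviCivitaCoeff (i : σ.Index) (x : M) (a b c : Fin 4) : ℝ :=
  (σ.structureFn i x a b c - σ.structureFn i x b c a + σ.structureFn i x c a b) / 2

/-- The spin connection `ω(e_a) = ¼ ∑_{b c} ⟨∇_{e_a} e_b, e_c⟩ γ^c γ^b`, which satisfies
`[ω(e_a), γ(e_b)] = γ(∇_{e_a} e_b)`. -/
def spinConnection (i : σ.Index) (x : M) (a : Fin 4) : Matrix SpinIdx SpinIdx ℂ :=
  ∑ b, ∑ c, ((σ.leviCivitaCoeff i x a b c / 4 : ℝ) : ℂ) • (diracMatrix c * diracMatrix b)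

/-- Families of local `S ⊗ ℂ³²`-valued functions, one for each member of the cover. -/
abbrev LocalSpinors := σ.Index → M → FullIdx → ℂ

/-- Smooth sections of the bundle `S ⊗ ℂ³²`, given by their components over the members of the
cover; components are extended by zero outside `U i`. They form the dense subspace of
`L²(M, S) ⊗ ℂ³²` on which the Dirac operator is defined. -/
def smoothSpinors : Submodule ℂ σ.LocalSpinors where
  carrier := {ψ |
    (∀ i, ContMDiffOn (𝓡 4) 𝓘(ℝ, FullIdx → ℂ) ∞ (ψ i) (σ.U i)) ∧
    (∀ i, ∀ x ∉ σ.U i, ψ i x = 0) ∧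
    (∀ i j, ∀ x ∈ σ.U i ∩ σ.U j, ψ i x = spinAct (σ.lift i j x) *ᵥ ψ j x)}
  zero_mem' := ⟨fun _ => contMDiffOn_const, fun _ _ _ => rfl, fun _ _ _ _ => by simp⟩
  add_mem' := fun {ψ φ} hψ hφ => ⟨fun i => (hψ.1 i).add (hφ.1 i),
    fun i x hx => by simp [hψ.2.1 i x hx, hφ.2.1 i x hx],
    fun i j x hx => by
      simp only [Pi.add_apply, Matrix.mulVec_add, ← hψ.2.2 i j x hx, ← hφ.2.2 i j x hx]⟩
  smul_mem' := fun c ψ hψ => ⟨fun i => by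
      have h : ContDiff ℝ ∞ fun v : FullIdx → ℂ => c • v := contDiff_id.const_smul c
      exact h.contMDiff.comp_contMDiffOn (hψ.1 i),
    fun i x hx => by simp [hψ.2.1 i x hx],
    fun i j x hx => by
      simp only [Pi.smul_apply, Matrix.mulVec_smul, ← hψ.2.2 i j x hx]⟩

open Classical in
/-- The free Dirac operator `D̸ = ∂̸ ⊗ 1 = -i γ^μ (∂_μ + ω_μ)`. -/
def dirac (ψ : σ.LocalSpinors) : σ.LocalSpinors := fun i x =>
  if x ∈ σ.U i then
    (-Complex.I) • ∑ a, spinAct (diracMatrix a) *ᵥ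
      (id (α := FullIdx → ℂ) (mfderiv (𝓡 4) 𝓘(ℝ, FullIdx → ℂ) (ψ i) x (σ.frame i a x)) +
        spinAct (σ.spinConnection i x a) *ᵥ ψ i x)
  else 0

/-- The pointwise hermitian product of two spinor fields (computed in some member of the cover that
contains the point). -/
def fibreInner (ψ φ : σ.LocalSpinors) (x : M) : ℂ :=
  star (ψ (σ.exists_mem_U x).choose x) ⬝ᵥ φ (σ.exists_mem_U x).choose x

/-- The inner product of `L²(M, S) ⊗ ℂ³²`. -/
def innerL2 [CompactSpace M] [T2Space M] [MeasurableSpace M] (ψ φ : σ.LocalSpinors) : ℂ :=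
  ∫ x, σ.fibreInner ψ φ x ∂(riemannianVolume g)

/-- Operators defined on the smooth sections of `S ⊗ ℂ³²`. -/
abbrev Operator := σ.smoothSpinors → σ.LocalSpinors

/-- Selfadjointness of a (bounded) operator, tested on the dense subspace of smooth spinors. -/
def IsSelfadjoint [CompactSpace M] [T2Space M] [MeasurableSpace M] (T : σ.Operator) : Prop :=
  ∀ ψ φ : σ.smoothSpinors, σ.innerL2 (T ψ) φ = σ.innerL2 ψ (T φ)

end SpinStructure

/-! ### The twisted algebra and free 1-forms -/

/-- The algebra `C^∞(M) ⊗ A_SM ⊗ ℂ²`. -/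
abbrev TwistedAlgebra (M : Type*) [TopologicalSpace M] [ChartedSpace E4 M] :=
  ContMDiffMap (𝓡 4) 𝓘(ℝ, DoubleASM) M DoubleASM ∞

namespace SpinStructure

variable {g : Metric M} (σ : SpinStructure g)

/-- The representation of the algebra on spinors. -/
def act (a : M → DoubleASM) (ψ : σ.LocalSpinors) : σ.LocalSpinors :=
  fun i x => rep (a x) *ᵥ ψ i x

/-- The automorphism `ρ` that exchanges the two copies of `A_SM`. -/
def twist (a : M → DoubleASM) : M → DoubleASM := fun x => (a x).swap

/-- The twisted commutator `[D̸, b]_ρ = D̸ b - ρ(b) D̸`. -/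
def twistedCommutator (b : TwistedAlgebra M) : σ.Operator := fun ψ =>
  σ.dirac (σ.act b ψ) - σ.act (twist b) (σ.dirac ψ)

/-- Free 1-forms `∑_k a_k [D̸, b_k]_ρ`. -/
def IsFreeOneForm (T : σ.Operator) : Prop :=
  ∃ (n : ℕ) (a b : Fin n → TwistedAlgebra M),
    T = fun ψ => ∑ k, σ.act (a k) (σ.twistedCommutator (b k) ψ)

open Classical in
/-- The operator `-i γ^μ A_μ` of an algebra-valued 1-form `A`. -/
def slashed (A : OneForm M DoubleASM) : σ.Operator := fun ψ i x =>
  if x ∈ σ.U i then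
    (-Complex.I) • ∑ a, spinAct (diracMatrix a) *ᵥ
      (rep (A x (σ.frame i a x)) *ᵥ (ψ : σ.LocalSpinors) i x)
  else 0

/-- The unimodularity condition `Tr A_μ = 0` on the components of `T = -i γ^μ A_μ`. -/
def IsUnimodular (T : σ.Operator) : Prop :=
  ∃ A : OneForm M DoubleASM, T = σ.slashed A ∧
    ∀ (x : M) (v : TangentSpace (𝓡 4) x), (rep (A x v)).trace = 0

end SpinStructure

/-! ### Fields -/

/-- The Lie algebra `𝔰𝔲(n)`: traceless antiselfadjoint matrices. -/
def su (n : ℕ) : Set (Matrix (Fin n) (Fin n) ℂ) :=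
  {X | Xᴴ = -X ∧ X.trace = 0}

/-- The fields `a, w, g, B, W, V`. Since `B` is real, `iB` takes values in `𝔲(1) = iℝ`. -/
@[ext]
structure Fields (M : Type*) [TopologicalSpace M] [ChartedSpace E4 M] [IsManifold (𝓡 4) ∞ M] where
  /-- A real 1-form. -/
  a : OneForm M ℝ
  /-- A real 1-form. -/
  w : OneForm M ℝ
  /-- A selfadjoint `M₃(ℂ)`-valued 1-form. -/
  g : OneForm M (Matrix (Fin 3) (Fin 3) ℂ)
  /-- The hypercharge field. -/
  B : OneForm M ℝ
  /-- The weak field. -/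
  W : OneForm M (Matrix (Fin 2) (Fin 2) ℂ)
  /-- The strong field. -/
  V : OneForm M (Matrix (Fin 3) (Fin 3) ℂ)
  g_selfadjoint : ∀ (x : M) (v : TangentSpace (𝓡 4) x), Matrix.IsHermitian (g x v)
  W_mem : ∀ (x : M) (v : TangentSpace (𝓡 4) x), Complex.I • W x v ∈ su 2
  V_mem : ∀ (x : M) (v : TangentSpace (𝓡 4) x), Complex.I • V x v ∈ su 3

/-- The components of `A` are given by the fields `F` and by the trace part `V⁰` of the `M₃(ℂ)`-valued
component as
`c^r = a - i g₁B/2`, `c^l = -a - i g₁B/2`, `q^r = w - i g₂W/2`, `q^l = -w - i g₂W/2`,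
`m^r = g + i(V⁰ + g₃V/2)`, `m^l = -g + i(V⁰ + g₃V/2)`. Under the representation, a component `Q_μ^r`
or `M_μ^r` of `A_μ` involves `(c^r, q^r, m^r)`, so that `A_μ` is the element
`((c^r, q^l, m^r), (c^l, q^r, m^l))` of the doubled algebra. -/
def HasFields (g₁ g₂ g₃ : ℝ) (A : OneForm M DoubleASM) (F : Fields M) (V0 : OneForm M ℝ) : Prop :=
  ∀ (x : M) (v : TangentSpace (𝓡 4) x),
    let A' : DoubleASM := A x v
    let a : ℝ := F.a x v
    let w : ℝ := F.w x v
    let g : Matrix (Fin 3) (Fin 3) ℂ := F.g x v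
    let B : ℝ := F.B x v
    let W : Matrix (Fin 2) (Fin 2) ℂ := F.W x v
    let V : Matrix (Fin 3) (Fin 3) ℂ := F.V x v
    let v0 : ℝ := V0 x v
    A'.1.1 = a - Complex.I * (g₁ / 2) * B ∧
    A'.2.1 = -a - Complex.I * (g₁ / 2) * B ∧
    quatMatrix A'.2.2.1 = (w : ℂ) • (1 : Matrix (Fin 2) (Fin 2) ℂ) - (Complex.I * (g₂ / 2)) • W ∧
    quatMatrix A'.1.2.1 = -(w : ℂ) • (1 : Matrix (Fin 2) (Fin 2) ℂ) - (Complex.I * (g₂ / 2)) • W ∧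
    A'.1.2.2 = g + Complex.I • ((v0 : ℂ) • (1 : Matrix (Fin 3) (Fin 3) ℂ) + (g₃ / 2 : ℂ) • V) ∧
    A'.2.2.2 = -g + Complex.I • ((v0 : ℂ) • (1 : Matrix (Fin 3) (Fin 3) ℂ) + (g₃ / 2 : ℂ) • V)

end Geometry

end TwistedSM

end

/-!
The Dirac matrices are off-diagonal in the chirality, and the twist exchanges the two chiral
representations of the algebra. Hence `a γ^μ = γ^μ ρ(a)` (`rep_mul_diracMatrix`). In the twisted
commutator `[D̸, b]_ρ` the derivatives of the spinor therefore cancel, and so does the spin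
connection, which is even in the Dirac matrices and commutes with the algebra. What remains is
multiplication by `-i γ^μ ∂_μ b` (`SpinStructure.twistedCommutator_eq`), so that `∑ a_k [D̸, b_k]_ρ`
is `-i γ^μ A_μ` with `A = ∑ ρ(a_k) db_k`. Conversely, on a compact manifold every algebra-valued
1-form is a finite sum of products `f dh` with `h` real-valued
(`OneForm.exists_eq_sum_diffAt_smul`): bump functions extend the local coordinates. The free 1-forms
are thus exactly the operators `-i γ^μ A_μ` (`SpinStructure.isFreeOneForm_iff`), and `A` is unique
since the Dirac matrices are linearly independent over the represented algebra
(`SpinStructure.slashed_injective`).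

Such an operator multiplies by a matrix in each fibre. Testing its symmetry on `f ψ` for all smooth
functions `f`, and using that the Riemannian volume is finite and charges every nonempty open set,
shows that it is selfadjoint if and only if each of these matrices is hermitian, that is, if and
only if `A = -ρ(A^*)` (`SpinStructure.isSelfadjoint_slashed_iff`).

The rest is linear algebra at a point. The solutions of `X = -ρ(X^*)` in the algebra are
parametrized linearly by the values of the seven fields (`fieldRel_toFieldValues`,
`fieldRel_ofFieldValues`, `FieldRel.unique`), and the trace of the representation is a multiple of `V⁰ - g₁ B / 6`
(`FieldRel.trace_rep_eq_zero_iff`). As both directions of the parametrization are linear maps with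
constant coefficients, they carry smooth 1-forms to smooth 1-forms.
-/

noncomputable section

namespace TwistedSM

/-! ### The representation of the algebra and the Dirac matrices -/

theorem quatMatrix_mul (p q : ℍ[ℝ]) : quatMatrix (p * q) = quatMatrix p * quatMatrix q := by
  ext i j
  fin_cases i <;> fin_cases j <;>
    (apply Complex.ext <;> simp [quatMatrix, Matrix.mul_apply, Fin.sum_univ_two] <;> ring)

theorem quatMatrix_add (p q : ℍ[ℝ]) : quatMatrix (p + q) = quatMatrix p + quatMatrix q := by
  ext i j
  fin_cases i <;> fin_cases j <;>
    (apply Complex.ext <;> simp [quatMatrix] <;> ring)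

theorem quatMatrix_smul (r : ℝ) (q : ℍ[ℝ]) : quatMatrix (r • q) = r • quatMatrix q := by
  ext i j
  fin_cases i <;> fin_cases j <;> (apply Complex.ext <;> simp [quatMatrix])

theorem quatMatrix_star (q : ℍ[ℝ]) : quatMatrix (star q) = (quatMatrix q)ᴴ := by
  ext i j
  fin_cases i <;> fin_cases j <;> (apply Complex.ext <;> simp [quatMatrix])

theorem quatMatrix_injective : Function.Injective quatMatrix := by
  intro p q h
  have h0 := congrFun (congrFun h 0) 0
  have h1 := congrFun (congrFun h 0) 1
  simp only [quatMatrix, Matrix.of_apply, Matrix.cons_val', Matrix.cons_val_zero,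
    Matrix.cons_val_fin_one, Complex.mk.injEq, Matrix.cons_val_one] at h0 h1
  exact QuaternionAlgebra.ext h0.1 h0.2 h1.1 h1.2

theorem flavourBlock_mul (c d : ℂ) (p q : ℍ[ℝ]) :
    flavourBlock (c * d) (p * q) = flavourBlock c p * flavourBlock d q := by
  simp only [flavourBlock, Matrix.fromBlocks_multiply, quatMatrix_mul, Matrix.diagonal_mul_diagonal]
  congr 1
  · simp only [Matrix.mul_zero, add_zero]
    congr 1
    ext i
    fin_cases i <;> simp
  all_goals simp

theorem colourBlock_mul (c d : ℂ) (m n : Matrix (Fin 3) (Fin 3) ℂ) :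
    colourBlock (c * d) (m * n) = colourBlock c m * colourBlock d n := by
  simp [colourBlock, Matrix.fromBlocks_multiply]

theorem flavourBlock_add (c d : ℂ) (p q : ℍ[ℝ]) :
    flavourBlock (c + d) (p + q) = flavourBlock c p + flavourBlock d q := by
  simp only [flavourBlock, Matrix.fromBlocks_add, quatMatrix_add, Matrix.diagonal_add]
  congr 1
  · congr 1
    ext i
    fin_cases i <;> simp
  all_goals simp

theorem colourBlock_add (c d : ℂ) (m n : Matrix (Fin 3) (Fin 3) ℂ) :
    colourBlock (c + d) (m + n) = colourBlock c m + colourBlock d n := by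
  simp [colourBlock, Matrix.fromBlocks_add]

theorem flavourBlock_smul (r : ℝ) (c : ℂ) (p : ℍ[ℝ]) :
    flavourBlock (r • c) (r • p) = r • flavourBlock c p := by
  simp only [flavourBlock, Matrix.fromBlocks_smul, quatMatrix_smul, ← Matrix.diagonal_smul]
  congr 1
  · congr 1
    ext i
    fin_cases i <;> simp
  all_goals simp

theorem colourBlock_smul (r : ℝ) (c : ℂ) (m : Matrix (Fin 3) (Fin 3) ℂ) :
    colourBlock (r • c) (r • m) = r • colourBlock c m := by
  simp only [colourBlock, Matrix.fromBlocks_smul, ← Matrix.diagonal_smul, smul_zero]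
  rfl

theorem flavourBlock_star (c : ℂ) (p : ℍ[ℝ]) :
    flavourBlock (star c) (star p) = (flavourBlock c p)ᴴ := by
  simp only [flavourBlock, Matrix.fromBlocks_conjTranspose, quatMatrix_star,
    Matrix.diagonal_conjTranspose]
  congr 1
  · congr 1
    ext i
    fin_cases i <;> simp
  all_goals simp

theorem colourBlock_star (c : ℂ) (m : Matrix (Fin 3) (Fin 3) ℂ) :
    colourBlock (star c) (star m) = (colourBlock c m)ᴴ := by
  simp only [colourBlock, Matrix.fromBlocks_conjTranspose, Matrix.diagonal_conjTranspose,
    Matrix.conjTranspose_zero]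
  rfl

theorem repRight_swap (a : DoubleASM) : repRight a.swap = repLeft a := rfl

theorem repLeft_swap (a : DoubleASM) : repLeft a.swap = repRight a := rfl

theorem repRight_mul (a b : DoubleASM) : repRight (a * b) = repRight a * repRight b := by
  simp only [repRight, Prod.fst_mul, Prod.snd_mul, Matrix.fromBlocks_multiply, flavourBlock_mul,
    colourBlock_mul, Matrix.mul_zero, Matrix.zero_mul, add_zero, zero_add, Matrix.mul_add,
    Matrix.add_mul]
  congr 1
  · rw [← Matrix.mul_kronecker_mul, Matrix.one_mul]
  · simp only [← Matrix.mul_kronecker_mul, Matrix.fromBlocks_multiply, Matrix.mul_zero,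
      add_zero, zero_add, Matrix.mul_one, Matrix.fromBlocks_zero, Matrix.kronecker_zero]

theorem repRight_add (a b : DoubleASM) : repRight (a + b) = repRight a + repRight b := by
  simp only [repRight, Prod.fst_add, Prod.snd_add, Matrix.fromBlocks_add, flavourBlock_add,
    colourBlock_add, add_zero]
  congr 1
  · exact Matrix.kronecker_add _ _ _
  · simp only [Matrix.add_kronecker]
    abel

theorem repRight_smul (r : ℝ) (a : DoubleASM) : repRight (r • a) = r • repRight a := by
  simp only [repRight, Prod.smul_fst, Prod.smul_snd, Matrix.fromBlocks_smul, flavourBlock_smul,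
    colourBlock_smul, smul_zero, smul_add]
  congr 1
  · exact Matrix.kronecker_smul _ _ _
  · simp only [Matrix.smul_kronecker]

theorem repRight_star (a : DoubleASM) : repRight (star a) = (repRight a)ᴴ := by
  simp only [repRight, Prod.fst_star, Prod.snd_star, Matrix.fromBlocks_conjTranspose,
    flavourBlock_star, colourBlock_star, Matrix.conjTranspose_add, Matrix.conjTranspose_zero]
  congr 1
  · rw [Matrix.conjTranspose_kronecker, Matrix.conjTranspose_one]
  · simp only [Matrix.conjTranspose_kronecker, Matrix.fromBlocks_conjTranspose,
      Matrix.conjTranspose_zero, Matrix.conjTranspose_one]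

/-- `rep a` restricted to the spinor index `s`. -/
def chiralRep (a : DoubleASM) (s : SpinIdx) : Matrix InternalIdx InternalIdx ℂ :=
  Sum.elim (fun _ => repRight a) (fun _ => repLeft a) s

theorem rep_eq (a : DoubleASM) : rep a = Matrix.blockDiagonal (chiralRep a) := rfl

theorem chiralRep_mul (a b : DoubleASM) : chiralRep (a * b) = chiralRep a * chiralRep b := by
  ext1 s
  rcases s with s | s
  · exact repRight_mul a b
  · exact repRight_mul a.swap b.swap

theorem rep_mul (a b : DoubleASM) : rep (a * b) = rep a * rep b := by
  rw [rep_eq, rep_eq, rep_eq, ← Matrix.blockDiagonal_mul, chiralRep_mul]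
  rfl

theorem rep_add (a b : DoubleASM) : rep (a + b) = rep a + rep b := by
  rw [rep_eq, rep_eq, rep_eq, ← Matrix.blockDiagonal_add]
  congr 1
  ext1 s
  rcases s with s | s
  · exact repRight_add a b
  · exact repRight_add a.swap b.swap

theorem rep_smul (r : ℝ) (a : DoubleASM) : rep (r • a) = r • rep a := by
  rw [rep_eq, rep_eq, ← Matrix.blockDiagonal_smul]
  congr 1
  ext1 s
  rcases s with s | s
  · exact repRight_smul r a
  · exact repRight_smul r a.swap

theorem rep_star (a : DoubleASM) : rep (star a) = (rep a)ᴴ := by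
  rw [rep_eq, rep_eq, Matrix.blockDiagonal_conjTranspose]
  congr 1
  ext1 s
  rcases s with s | s
  · exact repRight_star a
  · exact repRight_star a.swap

/-- The representation as a real-linear map. -/
def repL : DoubleASM →ₗ[ℝ] Matrix FullIdx FullIdx ℂ where
  toFun := rep
  map_add' := rep_add
  map_smul' := rep_smul

theorem rep_sum {ι : Type*} (s : Finset ι) (f : ι → DoubleASM) :
    rep (∑ k ∈ s, f k) = ∑ k ∈ s, rep (f k) :=
  map_sum repL f s

theorem spinAct_mul (S S' : Matrix SpinIdx SpinIdx ℂ) :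
    spinAct (S * S') = spinAct S * spinAct S' := by
  simp only [spinAct]
  rw [← Matrix.mul_kronecker_mul, Matrix.one_mul]

theorem spinAct_one : spinAct 1 = 1 := Matrix.one_kronecker_one

theorem spinAct_conjTranspose (S : Matrix SpinIdx SpinIdx ℂ) :
    (spinAct S)ᴴ = spinAct Sᴴ := by
  simp only [spinAct]
  rw [Matrix.conjTranspose_kronecker, Matrix.conjTranspose_one]

/-- Multiplication by a spinor matrix as a complex-linear map. -/
def spinActL : Matrix SpinIdx SpinIdx ℂ →ₗ[ℂ] Matrix FullIdx FullIdx ℂ where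
  toFun := spinAct
  map_add' _ _ := Matrix.kronecker_add _ _ _
  map_smul' _ _ := Matrix.kronecker_smul _ _ _

@[simp] theorem spinActL_apply (S : Matrix SpinIdx SpinIdx ℂ) : spinActL S = spinAct S := rfl

theorem spinAct_mul_rep_apply (S : Matrix SpinIdx SpinIdx ℂ) (a : DoubleASM)
    (p q : FullIdx) : (spinAct S * rep a) p q = S p.2 q.2 * chiralRep a q.2 p.1 q.1 := by
  obtain ⟨i, s⟩ := p
  obtain ⟨j, t⟩ := q
  simp [Matrix.mul_apply, spinAct, rep_eq, Matrix.blockDiagonal_apply, Fintype.sum_prod_type,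
    Matrix.one_apply, Finset.sum_ite_eq]

theorem rep_mul_spinAct_apply (S : Matrix SpinIdx SpinIdx ℂ) (a : DoubleASM)
    (p q : FullIdx) : (rep a * spinAct S) p q = S p.2 q.2 * chiralRep a p.2 p.1 q.1 := by
  obtain ⟨i, s⟩ := p
  obtain ⟨j, t⟩ := q
  simp [Matrix.mul_apply, spinAct, rep_eq, Matrix.blockDiagonal_apply, Fintype.sum_prod_type,
    Matrix.one_apply, Finset.sum_ite_eq, mul_comm]

theorem spinAct_diag_mul_rep (R L : Matrix (Fin 2) (Fin 2) ℂ) (a : DoubleASM) :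
    spinAct (Matrix.fromBlocks R 0 0 L) * rep a = rep a * spinAct (Matrix.fromBlocks R 0 0 L) := by
  ext ⟨i, s⟩ ⟨j, t⟩
  rw [spinAct_mul_rep_apply, rep_mul_spinAct_apply]
  rcases s with s | s <;> rcases t with t | t <;> simp [chiralRep]

theorem rep_mul_spinAct_offDiag (R L : Matrix (Fin 2) (Fin 2) ℂ) (a : DoubleASM) :
    rep a * spinAct (Matrix.fromBlocks 0 R L 0) =
      spinAct (Matrix.fromBlocks 0 R L 0) * rep a.swap := by
  ext ⟨i, s⟩ ⟨j, t⟩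
  rw [spinAct_mul_rep_apply, rep_mul_spinAct_apply]
  rcases s with s | s <;> rcases t with t | t <;>
    simp [chiralRep, repRight_swap, repLeft_swap]

/-- The Dirac matrices exchange the chiralities, so they intertwine the representation with its
twist. -/
theorem rep_mul_diracMatrix (a : DoubleASM) (k : Fin 4) :
    rep a * spinAct (diracMatrix k) = spinAct (diracMatrix k) * rep a.swap :=
  rep_mul_spinAct_offDiag _ _ a

theorem diracMatrix_conjTranspose (k : Fin 4) : (diracMatrix k)ᴴ = diracMatrix k := by
  have h : (sigma k)ᴴ = sigmaTilde k := by
    refine Fin.cases ?_ (fun j => ?_) k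
    · simp [sigma, sigmaTilde]
    · simp only [sigma, sigmaTilde, Fin.cons_succ]
      fin_cases j <;> ext i l <;> fin_cases i <;> fin_cases l <;> simp [pauli]
  have h' : (sigmaTilde k)ᴴ = sigma k := by rw [← h, Matrix.conjTranspose_conjTranspose]
  simp [diracMatrix, Matrix.fromBlocks_conjTranspose, h, h']

theorem sigma_linearIndependent (x : Fin 4 → ℂ) (h : ∀ k l, ∑ a, sigma a k l * x a = 0) :
    x = 0 := by
  have h00 := h 0 0
  have h01 := h 0 1
  have h10 := h 1 0
  have h11 := h 1 1
  simp [sigma, pauli, Fin.sum_univ_succ] at h00 h01 h10 h11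
  have hI := Complex.I_mul_I
  ext a
  fin_cases a
  · show x 0 = 0
    linear_combination (h00 + h11) / 2
  · show x 1 = 0
    linear_combination Complex.I * (h01 + h10) / 2 + x 1 * hI
  · show x 2 = 0
    linear_combination (h10 - h01) / 2
  · show x 3 = 0
    linear_combination Complex.I * (h00 - h11) / 2 + x 3 * hI

theorem sigmaTilde_linearIndependent (x : Fin 4 → ℂ)
    (h : ∀ k l, ∑ a, sigmaTilde a k l * x a = 0) : x = 0 := by
  have h00 := h 0 0
  have h01 := h 0 1
  have h10 := h 1 0
  have h11 := h 1 1
  simp [sigmaTilde, pauli, Fin.sum_univ_succ] at h00 h01 h10 h11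
  have hI := Complex.I_mul_I
  ext a
  fin_cases a
  · show x 0 = 0
    linear_combination (h00 + h11) / 2
  · show x 1 = 0
    linear_combination -Complex.I * (h01 + h10) / 2 + x 1 * hI
  · show x 2 = 0
    linear_combination (h01 - h10) / 2
  · show x 3 = 0
    linear_combination -Complex.I * (h00 - h11) / 2 + x 3 * hI

theorem eq_zero_of_repRight_eq_zero_of_repLeft_eq_zero {a : DoubleASM} (hR : repRight a = 0)
    (hL : repLeft a = 0) : a = 0 := by
  have hQR : ∀ i j, quatMatrix a.2.2.1 i j = 0 := fun i j => by
    simpa [repRight, flavourBlock] using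
      congrFun (congrFun hR (.inl (.inl (), .inr i))) (.inl (.inl (), .inr j))
  have hQL : ∀ i j, quatMatrix a.1.2.1 i j = 0 := fun i j => by
    simpa [repLeft, flavourBlock] using
      congrFun (congrFun hL (.inl (.inl (), .inr i))) (.inl (.inl (), .inr j))
  have hC : a.1.1 = 0 := by
    simpa [repRight, colourBlock] using
      congrFun (congrFun hR (.inr (.inl (), .inl 0))) (.inr (.inl (), .inl 0))
  have hC' : a.2.1 = 0 := by
    simpa [repRight, colourBlock] using
      congrFun (congrFun hR (.inr (.inl (), .inr 0))) (.inr (.inl (), .inr 0))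
  have hM : ∀ i j, a.1.2.2 i j = 0 := fun i j => by
    simpa [repRight, colourBlock] using
      congrFun (congrFun hR (.inr (.inr i, .inl 0))) (.inr (.inr j, .inl 0))
  have hM' : ∀ i j, a.2.2.2 i j = 0 := fun i j => by
    simpa [repRight, colourBlock] using
      congrFun (congrFun hR (.inr (.inr i, .inr 0))) (.inr (.inr j, .inr 0))
  have h0 : quatMatrix 0 = 0 := by
    ext i j; fin_cases i <;> fin_cases j <;> (apply Complex.ext <;> simp [quatMatrix])
  refine Prod.ext (Prod.ext hC (Prod.ext ?_ ?_)) (Prod.ext hC' (Prod.ext ?_ ?_))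
  · exact quatMatrix_injective ((Matrix.ext hQL).trans h0.symm)
  · exact Matrix.ext hM
  · exact quatMatrix_injective ((Matrix.ext hQR).trans h0.symm)
  · exact Matrix.ext hM'

/-- The Dirac matrices are linearly independent over the represented algebra. -/
theorem eq_zero_of_sum_diracMatrix_mul_rep_eq_zero {X : Fin 4 → DoubleASM}
    (h : ∑ a, spinAct (diracMatrix a) * rep (X a) = 0) : X = 0 := by
  have key : ∀ (i j : InternalIdx) (s t : SpinIdx),
      ∑ a, diracMatrix a s t * chiralRep (X a) t i j = 0 := fun i j s t => by
    simpa [Matrix.sum_apply, spinAct_mul_rep_apply] using congrFun (congrFun h (i, s)) (j, t)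
  ext1 a
  refine eq_zero_of_repRight_eq_zero_of_repLeft_eq_zero ?_ ?_
  · ext i j
    exact congrFun (sigmaTilde_linearIndependent (fun a => repRight (X a) i j)
      fun k l => key i j (.inr k) (.inl l)) a
  · ext i j
    exact congrFun (sigma_linearIndependent (fun a => repLeft (X a) i j)
      fun k l => key i j (.inl k) (.inr l)) a

/-- The matrix `-i γ^μ X_μ`. -/
def slashMatrix (X : Fin 4 → DoubleASM) : Matrix FullIdx FullIdx ℂ :=
  (-Complex.I) • ∑ a, spinAct (diracMatrix a) * rep (X a)

theorem slashMatrix_injective : Function.Injective slashMatrix := by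
  intro X Y h
  have h' := smul_right_injective _ (neg_ne_zero.2 Complex.I_ne_zero) h
  refine sub_eq_zero.1 (eq_zero_of_sum_diracMatrix_mul_rep_eq_zero (X := X - Y) ?_)
  have : ∀ a, rep ((X - Y) a) = rep (X a) - rep (Y a) := fun a => map_sub repL _ _
  simp only [this, Matrix.mul_sub, Finset.sum_sub_distrib, h', sub_self]

theorem slashMatrix_sum {ι : Type*} (s : Finset ι) (X : ι → Fin 4 → DoubleASM) :
    slashMatrix (fun a => ∑ k ∈ s, X k a) = ∑ k ∈ s, slashMatrix (X k) := by
  simp only [slashMatrix, rep_sum, Matrix.mul_sum]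
  rw [Finset.sum_comm, Finset.smul_sum]

theorem rep_mul_slashMatrix (b : DoubleASM) (X : Fin 4 → DoubleASM) :
    rep b * slashMatrix X = slashMatrix fun a => b.swap * X a := by
  simp only [slashMatrix, Matrix.mul_smul, Matrix.mul_sum, rep_mul, ← Matrix.mul_assoc,
    rep_mul_diracMatrix]

/-- The adjoint of `-i γ^μ X_μ` is `-i γ^μ Y_μ` with `Y_μ = -ρ(X_μ^*)`. -/
theorem slashMatrix_conjTranspose (X : Fin 4 → DoubleASM) :
    (slashMatrix X)ᴴ = slashMatrix fun a => -(star (X a)).swap := by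
  have hneg : ∀ Y, rep (-Y) = -rep Y := fun Y => map_neg repL Y
  rw [slashMatrix, slashMatrix, Matrix.conjTranspose_smul, Matrix.conjTranspose_sum, star_neg,
    Complex.star_def, Complex.conj_I, neg_neg, ← neg_neg (Complex.I • _), ← neg_smul, ← smul_neg,
    ← Finset.sum_neg_distrib]
  congr 1
  refine Finset.sum_congr rfl fun a _ => ?_
  rw [Matrix.conjTranspose_mul, ← rep_star, spinAct_conjTranspose, diracMatrix_conjTranspose,
    rep_mul_diracMatrix, hneg, Matrix.mul_neg]

theorem isHermitian_slashMatrix_iff (X : Fin 4 → DoubleASM) :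
    (slashMatrix X).IsHermitian ↔ ∀ a, X a = -(star (X a)).swap := by
  rw [Matrix.IsHermitian, slashMatrix_conjTranspose, slashMatrix_injective.eq_iff, funext_iff]
  exact forall_congr' fun a => eq_comm

theorem trace_repRight (a : DoubleASM) : (repRight a).trace =
    4 * (a.1.1 + star a.1.1 + (quatMatrix a.2.2.1).trace) +
      2 * (a.1.1 + a.2.1 + a.1.2.2.trace + a.2.2.2.trace) := by
  rw [repRight]
  simp only [Matrix.trace, Matrix.diag_apply, Fintype.sum_sum_type, Fintype.sum_prod_type]
  simp [flavourBlock, colourBlock, Fin.sum_univ_succ]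
  ring

theorem trace_rep (a : DoubleASM) : (rep a).trace =
    8 * (a.1.1 + star a.1.1 + a.2.1 + star a.2.1 + (quatMatrix a.1.2.1).trace +
      (quatMatrix a.2.2.1).trace) + 8 * (a.1.1 + a.2.1 + a.1.2.2.trace + a.2.2.2.trace) := by
  have h : (repLeft a).trace = _ := trace_repRight a.swap
  rw [rep_eq, Matrix.trace_blockDiagonal]
  simp only [chiralRep, Fintype.sum_sum_type, Sum.elim_inl, Sum.elim_inr, Finset.sum_const,
    trace_repRight, h, Prod.fst_swap, Prod.snd_swap, Finset.card_univ, Fintype.card_fin]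
  simp only [nsmul_eq_mul]
  push_cast
  ring

/-! ### Vector-valued 1-forms -/

section Forms

variable {M : Type*} [TopologicalSpace M] [ChartedSpace E4 M]
  {U V W : Type*} [NormedAddCommGroup U] [NormedSpace ℝ U] [NormedAddCommGroup V]
  [NormedSpace ℝ V] [NormedAddCommGroup W] [NormedSpace ℝ W]

/-- The derivative of a vector-valued function as a linear map with values in that vector space. -/
abbrev diffAt (f : M → V) (x : M) : TangentSpace (𝓡 4) x →L[ℝ] V := mfderiv (𝓡 4) 𝓘(ℝ, V) f x

theorem diffAt_clm_comp (L : V →L[ℝ] W) {f : M → V} {x : M}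
    (hf : MDifferentiableAt (𝓡 4) 𝓘(ℝ, V) f x) (v : TangentSpace (𝓡 4) x) :
    diffAt (fun y => L (f y)) x v = L (diffAt f x v) := by
  have h := (L.hasMFDerivAt (x := f x)).comp x hf.hasMFDerivAt
  exact congrArg (fun T : TangentSpace (𝓡 4) x →L[ℝ] W => T v) h.mfderiv

/-- The product rule. -/
theorem diffAt_bilin (B : V →L[ℝ] W →L[ℝ] U) {f : M → V} {g : M → W} {x : M}
    (hf : MDifferentiableAt (𝓡 4) 𝓘(ℝ, V) f x) (hg : MDifferentiableAt (𝓡 4) 𝓘(ℝ, W) g x)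
    (v : TangentSpace (𝓡 4) x) :
    diffAt (fun y => B (f y) (g y)) x v = B (f x) (diffAt g x v) + B (diffAt f x v) (g x) := by
  have hB := (B.isBoundedBilinearMap.hasFDerivAt (f x, g x)).hasMFDerivAt
  have hfg := hf.prodMk_space hg
  have h := congrArg (fun T : TangentSpace (𝓡 4) x →L[ℝ] U => T v)
    (HasMFDerivAt.comp x (f := fun y => (f y, g y)) hB hfg.hasMFDerivAt).mfderiv
  have h1 : diffAt f x v = (diffAt (fun y => (f y, g y)) x v).1 :=
    diffAt_clm_comp (ContinuousLinearMap.fst ℝ V W) hfg v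
  have h2 : diffAt g x v = (diffAt (fun y => (f y, g y)) x v).2 :=
    diffAt_clm_comp (ContinuousLinearMap.snd ℝ V W) hfg v
  rw [h1, h2]
  exact h

theorem contMDiffOn_bilin (B : V →L[ℝ] W →L[ℝ] U) {f : M → V} {g : M → W} {s : Set M}
    (hf : ContMDiffOn (𝓡 4) 𝓘(ℝ, V) ∞ f s) (hg : ContMDiffOn (𝓡 4) 𝓘(ℝ, W) ∞ g s) :
    ContMDiffOn (𝓡 4) 𝓘(ℝ, U) ∞ (fun x => B (f x) (g x)) s :=
  (B.contMDiff.comp_contMDiffOn hf).clm_apply hg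

variable [IsManifold (𝓡 4) ∞ M]

/-- The vectors of `ℝ⁴` as tangent vectors at `x`, through the chart at `x₀`. -/
abbrev chartFrame (x₀ x : M) : E4 →L[ℝ] TangentSpace (𝓡 4) x :=
  (trivializationAt E4 (TangentSpace (𝓡 4)) x₀).symmL ℝ x

/-- A `V`-valued 1-form is smooth if its components in the charts are smooth functions. -/
theorem contMDiffAt_oneForm_iff {A : ∀ x : M, TangentSpace (𝓡 4) x →L[ℝ] V} {x₀ : M} :
    ContMDiffAt (𝓡 4) ((𝓡 4).prod 𝓘(ℝ, E4 →L[ℝ] V)) ∞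
      (fun x => Bundle.TotalSpace.mk' (E4 →L[ℝ] V)
        (E := fun x : M => TangentSpace (𝓡 4) x →L[ℝ] Bundle.Trivial M V x) x (A x)) x₀ ↔
    ContMDiffAt (𝓡 4) 𝓘(ℝ, E4 →L[ℝ] V) ∞ (fun x => (A x).comp (chartFrame x₀ x)) x₀ := by
  rw [contMDiffAt_hom_bundle]
  rw [and_iff_right (show ContMDiffAt (𝓡 4) (𝓡 4) ∞ (fun x : M => x) x₀ from contMDiffAt_id)]
  simp only [ContinuousLinearMap.inCoordinates, Bundle.TotalSpace.mk']
  rw [iff_iff_eq]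
  congr 1
  ext1 x
  have : (trivializationAt V (Bundle.Trivial M V) x₀).continuousLinearMapAt ℝ x =
    ContinuousLinearMap.id ℝ V := Bundle.Trivial.continuousLinearMapAt_trivialization ℝ M V x
  rw [this]
  rfl

/-- A pointwise family of linear maps that is smooth in the charts, as a smooth 1-form. -/
def OneForm.of (A : ∀ x : M, TangentSpace (𝓡 4) x →L[ℝ] V)
    (h : ∀ x₀, ContMDiffAt (𝓡 4) 𝓘(ℝ, E4 →L[ℝ] V) ∞ (fun x => (A x).comp (chartFrame x₀ x)) x₀) :
    OneForm M V :=
  ⟨A, fun x₀ => contMDiffAt_oneForm_iff.2 (h x₀)⟩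

theorem OneForm.contMDiffAt_comp_chartFrame (A : OneForm M V) (x₀ : M) :
    ContMDiffAt (𝓡 4) 𝓘(ℝ, E4 →L[ℝ] V) ∞
      (fun x => (show TangentSpace (𝓡 4) x →L[ℝ] V from A x).comp (chartFrame x₀ x)) x₀ :=
  contMDiffAt_oneForm_iff.1 (A.contMDiff x₀)

/-- The 1-form `L ∘ A`. -/
def OneForm.postcomp (L : V →L[ℝ] W) (A : OneForm M V) : OneForm M W :=
  OneForm.of (fun x => L.comp (show TangentSpace (𝓡 4) x →L[ℝ] V from A x)) fun x₀ => by
    have := contMDiffAt_const (c := L) |>.clm_comp (A.contMDiffAt_comp_chartFrame x₀)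
    exact this

@[simp] theorem OneForm.postcomp_apply (L : V →L[ℝ] W) (A : OneForm M V) (x : M)
    (v : TangentSpace (𝓡 4) x) : A.postcomp L x v = L (A x v) := rfl

/-- The product of a smooth function and a 1-form with respect to a bilinear map. -/
def OneForm.bilin (B : V →L[ℝ] W →L[ℝ] U) (f : M → V) (hf : ContMDiff (𝓡 4) 𝓘(ℝ, V) ∞ f)
    (A : OneForm M W) : OneForm M U :=
  OneForm.of (fun x => (B (f x)).comp (show TangentSpace (𝓡 4) x →L[ℝ] W from A x)) fun x₀ => by
    have h : ContMDiff (𝓡 4) 𝓘(ℝ, W →L[ℝ] U) ∞ fun x => B (f x) := B.contMDiff.comp hf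
    exact (h x₀).clm_comp (A.contMDiffAt_comp_chartFrame x₀)

/-- The differential of a smooth function, as a smooth 1-form. -/
def OneForm.d (f : M → V) (hf : ContMDiff (𝓡 4) 𝓘(ℝ, V) ∞ f) : OneForm M V :=
  OneForm.of (diffAt f) fun x₀ => by
    have h := (hf x₀).mfderiv_const (m := ∞) (by simp)
    unfold inTangentCoordinates at h
    simp only [ContinuousLinearMap.inCoordinates] at h
    refine h.congr_of_eventuallyEq (.of_forall fun x => ?_)
    ext v
    simp
    rfl

@[simp] theorem OneForm.d_apply {f : M → V} (hf : ContMDiff (𝓡 4) 𝓘(ℝ, V) ∞ f) (x : M) :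
    (OneForm.d f hf) x = diffAt f x := rfl

@[simp] theorem OneForm.add_apply (A B : OneForm M V) (x : M) (v : TangentSpace (𝓡 4) x) :
    (A + B) x v = A x v + B x v := rfl

/-- A finite sum of 1-forms. -/
def OneForm.sum {ι : Type*} (s : Finset ι) (A : ι → OneForm M V) : OneForm M V := ∑ k ∈ s, A k

theorem OneForm.sum_apply {ι : Type*} (s : Finset ι) (A : ι → OneForm M V) (x : M)
    (v : TangentSpace (𝓡 4) x) : OneForm.sum s A x v = ∑ k ∈ s, A k x v := by
  classical
  rw [OneForm.sum]
  induction s using Finset.induction_on with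
  | empty => rfl
  | insert k s hk ih => rw [Finset.sum_insert hk, Finset.sum_insert hk, OneForm.add_apply, ih]

theorem OneForm.ext_apply {A B : OneForm M V}
    (h : ∀ (x : M) (v : TangentSpace (𝓡 4) x), A x v = B x v) : A = B :=
  ContMDiffSection.ext fun x => ContinuousLinearMap.ext (h x)

/-- A smooth 1-form evaluated on a smooth vector field is a smooth function. -/
theorem OneForm.contMDiffOn_apply (A : OneForm M V) {X : ∀ x : M, TangentSpace (𝓡 4) x} {s : Set M}
    (hX : ContMDiffOn (𝓡 4) (𝓡 4).tangent ∞
      (fun x => (⟨x, X x⟩ : TangentBundle (𝓡 4) M)) s) :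
    ContMDiffOn (𝓡 4) 𝓘(ℝ, V) ∞ (fun x => (A x (X x) : V)) s := by
  have h := ContMDiffOn.clm_bundle_apply (A.contMDiff.contMDiffOn (s := s)) hX
  intro x hx
  have := (Bundle.contMDiffWithinAt_totalSpace.1 (h x hx)).2
  exact this

end Forms

/-! ### 1-forms are generated by differentials of functions -/

section Generation

variable {M : Type*} [TopologicalSpace M] [ChartedSpace E4 M] [IsManifold (𝓡 4) ∞ M]
  {V : Type*} [NormedAddCommGroup V] [NormedSpace ℝ V]

theorem contMDiffOn_chartFrame (c : M) (w : E4) :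
    ContMDiffOn (𝓡 4) (𝓡 4).tangent ∞
      (fun x => (⟨x, chartFrame c x w⟩ : TangentBundle (𝓡 4) M)) (chartAt E4 c).source := by
  have h := (trivializationAt E4 (TangentSpace (𝓡 4)) c).contMDiffOn_symmL (n := ∞) (IB := 𝓡 4)
  rw [TangentBundle.trivializationAt_baseSet] at h
  have hw : ContMDiffOn (𝓡 4) ((𝓡 4).prod 𝓘(ℝ, E4)) ∞
      (fun x => Bundle.TotalSpace.mk' E4 (E := Bundle.Trivial M E4) x w) (chartAt E4 c).source :=
    fun x _ => Bundle.contMDiffWithinAt_totalSpace.2 ⟨contMDiffWithinAt_id, contMDiffWithinAt_const⟩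
  exact ContMDiffOn.clm_bundle_apply h hw

/-- The `μ`-th coordinate function of the chart at `c`. -/
abbrev coordFn (c : M) (μ : Fin 4) (x : M) : ℝ := (extChartAt (𝓡 4) c x) μ

theorem contMDiffOn_coordFn (c : M) (μ : Fin 4) :
    ContMDiffOn (𝓡 4) 𝓘(ℝ, ℝ) ∞ (coordFn c μ) (chartAt E4 c).source :=
  (EuclideanSpace.proj (𝕜 := ℝ) μ : E4 →L[ℝ] ℝ).contMDiff.comp_contMDiffOn contMDiffOn_extChartAt

/-- A tangent vector is the combination of the coordinate vector fields whose coefficients are the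
differentials of the coordinates. -/
theorem sum_diffAt_coordFn_smul {c x : M} (hx : x ∈ (chartAt E4 c).source)
    (v : TangentSpace (𝓡 4) x) :
    ∑ μ, diffAt (coordFn c μ) x v • chartFrame c x (EuclideanSpace.single μ (1 : ℝ)) = v := by
  have hφ : MDifferentiableAt (𝓡 4) 𝓘(ℝ, E4) (extChartAt (𝓡 4) c) x :=
    mdifferentiableAt_extChartAt hx
  have h1 : ∀ μ, diffAt (coordFn c μ) x v =
      (diffAt (extChartAt (𝓡 4) c) x v) μ := fun μ =>
    diffAt_clm_comp (EuclideanSpace.proj (𝕜 := ℝ) μ : E4 →L[ℝ] ℝ) hφ v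
  have h2 : ∀ w : E4, ∑ μ, w μ • EuclideanSpace.single μ (1 : ℝ) = w := fun w => by
    ext i
    simp [Finset.sum_apply, Pi.single_apply]
  calc _ = chartFrame c x (∑ μ, (diffAt (extChartAt (𝓡 4) c) x v) μ •
        EuclideanSpace.single μ (1 : ℝ)) := by
        simp only [h1, map_sum, map_smul]
    _ = chartFrame c x (diffAt (extChartAt (𝓡 4) c) x v) := by rw [h2]
    _ = v := by
      change chartFrame c x (mfderiv (𝓡 4) 𝓘(ℝ, E4) (extChartAt (𝓡 4) c) x v) = v
      rw [← TangentBundle.continuousLinearMapAt_trivializationAt hx]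
      exact Bundle.Trivialization.symmL_continuousLinearMapAt _ (by simpa using hx) v

/-- On a compact manifold every smooth 1-form is a finite sum of products `f dh`, where the
functions `h` are real-valued. -/
theorem OneForm.exists_eq_sum_diffAt_smul [CompactSpace M] [T2Space M] (A : OneForm M V) :
    ∃ (n : ℕ) (f : Fin n → M → V) (h : Fin n → M → ℝ),
      (∀ k, ContMDiff (𝓡 4) 𝓘(ℝ, V) ∞ (f k)) ∧ (∀ k, ContMDiff (𝓡 4) 𝓘(ℝ, ℝ) ∞ (h k)) ∧
      ∀ (x : M) (v : TangentSpace (𝓡 4) x), A x v = ∑ k, diffAt (h k) x v • f k x := by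
  -- it suffices to produce a family indexed by some finite type
  suffices H : ∃ (ι : Type _) (_ : Fintype ι) (f : ι → M → V) (h : ι → M → ℝ),
      (∀ k, ContMDiff (𝓡 4) 𝓘(ℝ, V) ∞ (f k)) ∧ (∀ k, ContMDiff (𝓡 4) 𝓘(ℝ, ℝ) ∞ (h k)) ∧
      ∀ (x : M) (v : TangentSpace (𝓡 4) x), A x v = ∑ k, diffAt (h k) x v • f k x by
    obtain ⟨ι, _, f, h, hf, hh, hA⟩ := H
    let e := Fintype.equivFin ι
    refine ⟨Fintype.card ι, fun k => f (e.symm k), fun k => h (e.symm k), fun k => hf _,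
      fun k => hh _, fun x v => ?_⟩
    rw [hA, ← e.symm.sum_comp]
  -- With bump functions `β` in charts with coordinates `x^μ` and `S = ∑ β²`, the form `∑ X_μ dx^μ` is
  -- the sum of `S⁻¹ β² X_μ dx^μ = S⁻¹ β X_μ d(β x^μ) - S⁻¹ β x^μ X_μ dβ`, in which all functions are
  -- smooth on the whole manifold.
  let β : ∀ c : M, SmoothBumpFunction (𝓡 4) c := fun _ => Classical.arbitrary _
  obtain ⟨t, ht⟩ := isCompact_univ.elim_finite_subcover (fun c => Function.support (β c))
    (fun c => (β c).isOpen_support) (fun c _ => Set.mem_iUnion.2 ⟨c, (β c).c_mem_support⟩)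
  let S : M → ℝ := fun x => ∑ c ∈ t, β c x * β c x
  have hS : ∀ x, S x ≠ 0 := fun x => by
    obtain ⟨c, hc, hx⟩ := Set.mem_iUnion₂.1 (ht (Set.mem_univ x))
    exact (Finset.sum_pos' (f := fun c => β c x * β c x) (fun d _ => mul_self_nonneg _)
      ⟨c, hc, mul_self_pos.2 hx⟩).ne'
  have hSs : ContMDiff (𝓡 4) 𝓘(ℝ, ℝ) ∞ S := by
    refine ContMDiff.sum fun c _ => ?_
    exact (β c).contMDiff.mul (β c).contMDiff
  have hSi : ContMDiff (𝓡 4) 𝓘(ℝ, ℝ) ∞ fun x => (S x)⁻¹ := hSs.inv₀ hS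
  let X : M → Fin 4 → M → V := fun c μ x =>
    A x (chartFrame c x (EuclideanSpace.single μ (1 : ℝ)))
  have hX : ∀ c μ, ContMDiffOn (𝓡 4) 𝓘(ℝ, V) ∞ (X c μ) (chartAt E4 c).source := fun c μ =>
    A.contMDiffOn_apply (contMDiffOn_chartFrame c _)
  refine ⟨(t × Fin 4) ⊕ (t × Fin 4), inferInstance,
    Sum.elim (fun p x => (S x)⁻¹ • β p.1 x • X p.1 p.2 x)
      (fun p x => -((S x)⁻¹ • β p.1 x • (coordFn p.1.1 p.2 x • X p.1 p.2 x))),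
    Sum.elim (fun p x => β p.1 x • coordFn p.1.1 p.2 x) (fun p => β p.1), ?_, ?_, ?_⟩
  · rintro (⟨c, μ⟩ | ⟨c, μ⟩)
    · exact hSi.smul ((β c).contMDiff_smul (hX c μ))
    · exact (hSi.smul ((β c).contMDiff_smul ((contMDiffOn_coordFn _ μ).smul (hX c μ)))).neg
  · rintro (⟨c, μ⟩ | ⟨c, μ⟩)
    · exact (β c).contMDiff_smul (contMDiffOn_coordFn _ μ)
    · exact (β c).contMDiff
  · intro x v
    rw [Fintype.sum_sum_type, Fintype.sum_prod_type, Fintype.sum_prod_type,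
      ← Finset.sum_add_distrib]
    simp only [Sum.elim_inl, Sum.elim_inr, ← Finset.sum_add_distrib]
    have key : ∀ c : M, ∑ μ, (diffAt (fun y => β c y • coordFn c μ y) x v •
          ((S x)⁻¹ • β c x • X c μ x) + diffAt (β c) x v •
          -((S x)⁻¹ • β c x • (coordFn c μ x • X c μ x))) =
        ((S x)⁻¹ * (β c x * β c x)) • (A x v : V) := fun c => by
      by_cases h0 : β c x = 0
      · simp [h0]
      have hx : x ∈ (chartAt E4 c).source := (β c).support_subset_source h0
      have hd : ∀ μ, diffAt (fun y => β c y • coordFn c μ y) x v =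
          β c x * diffAt (coordFn c μ) x v + diffAt (β c) x v * coordFn c μ x := fun μ =>
        diffAt_bilin (ContinuousLinearMap.mul ℝ ℝ) ((β c).contMDiffAt.mdifferentiableAt (by simp))
          (((contMDiffOn_coordFn c μ).contMDiffAt
            ((chartAt E4 c).open_source.mem_nhds hx)).mdifferentiableAt (by simp)) v
      have hv := congrArg (A x) (sum_diffAt_coordFn_smul hx v)
      rw [map_sum] at hv
      simp only [map_smul] at hv
      rw [← hv, Finset.smul_sum]
      refine Finset.sum_congr rfl fun μ _ => ?_
      rw [hd]
      simp only [X]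
      module
    have hsum := Finset.sum_coe_sort t (fun c => ((S x)⁻¹ * (β c x * β c x)) • (A x v : V))
    simp only [key]
    rw [hsum, ← Finset.sum_smul, ← Finset.mul_sum, inv_mul_cancel₀ (hS x), one_smul]

end Generation

/-! ### Local matrices of the operators on the spinor bundle -/

/-- A linear map out of a finite-dimensional real normed space, as a continuous linear map. -/
abbrev clm {V W : Type*} [NormedAddCommGroup V] [NormedSpace ℝ V] [FiniteDimensional ℝ V]
    [NormedAddCommGroup W] [NormedSpace ℝ W] (f : V →ₗ[ℝ] W) : V →L[ℝ] W :=
  LinearMap.toContinuousLinearMap f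

/-- A bilinear map on finite-dimensional real normed spaces, as a continuous bilinear map. -/
abbrev clm₂ {U V W : Type*} [NormedAddCommGroup U] [NormedSpace ℝ U] [FiniteDimensional ℝ U]
    [NormedAddCommGroup V] [NormedSpace ℝ V] [FiniteDimensional ℝ V]
    [NormedAddCommGroup W] [NormedSpace ℝ W] (f : U →ₗ[ℝ] V →ₗ[ℝ] W) : U →L[ℝ] V →L[ℝ] W :=
  clm ((LinearMap.toContinuousLinearMap (𝕜 := ℝ) (E := V) (F' := W)).toLinearMap ∘ₗ f)

/-- The action of the doubled algebra on the fibre as a continuous bilinear map. -/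
def repB : DoubleASM →L[ℝ] (FullIdx → ℂ) →L[ℝ] (FullIdx → ℂ) :=
  clm₂ (LinearMap.mk₂ ℝ (fun a ψ => rep a *ᵥ ψ)
    (fun a b ψ => by rw [rep_add, Matrix.add_mulVec])
    (fun r a ψ => by rw [rep_smul, Matrix.smul_mulVec])
    (fun a ψ φ => Matrix.mulVec_add _ _ _)
    (fun r a ψ => Matrix.mulVec_smul _ _ _))

/-- The multiplication of the doubled algebra as a continuous bilinear map. -/
def mulB : DoubleASM →L[ℝ] DoubleASM →L[ℝ] DoubleASM := clm₂ (LinearMap.mul ℝ DoubleASM)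

theorem mulB_apply (a b : DoubleASM) : mulB a b = a * b := rfl

section SpinorBundle

variable {M : Type*} [TopologicalSpace M] [ChartedSpace E4 M]

theorem contMDiff_swap {V : Type*} [NormedAddCommGroup V] [NormedSpace ℝ V] {f : M → V × V}
    (hf : ContMDiff (𝓡 4) 𝓘(ℝ, V × V) ∞ f) :
    ContMDiff (𝓡 4) 𝓘(ℝ, V × V) ∞ fun x => (f x).swap :=
  ((ContinuousLinearMap.snd ℝ V V).prod (ContinuousLinearMap.fst ℝ V V)).contMDiff.comp hf

variable [IsManifold (𝓡 4) ∞ M]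

namespace SpinStructure

variable {g : Metric M} (σ : SpinStructure g)

theorem liftR_self {i : σ.Index} {x : M} (hx : x ∈ σ.U i) : σ.liftR i i x = 1 := by
  have h := σ.liftR_cocycle i i i x ⟨⟨hx, hx⟩, hx⟩
  have hu := Matrix.mem_unitaryGroup_iff'.1
    (Matrix.mem_specialUnitaryGroup_iff.1 (σ.liftR_mem i i x ⟨hx, hx⟩)).1
  calc σ.liftR i i x = star (σ.liftR i i x) * σ.liftR i i x * σ.liftR i i x := by rw [hu, one_mul]
    _ = 1 := by rw [mul_assoc, h, hu]

theorem liftL_self {i : σ.Index} {x : M} (hx : x ∈ σ.U i) : σ.liftL i i x = 1 := by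
  have h := σ.liftL_cocycle i i i x ⟨⟨hx, hx⟩, hx⟩
  have hu := Matrix.mem_unitaryGroup_iff'.1
    (Matrix.mem_specialUnitaryGroup_iff.1 (σ.liftL_mem i i x ⟨hx, hx⟩)).1
  calc σ.liftL i i x = star (σ.liftL i i x) * σ.liftL i i x * σ.liftL i i x := by rw [hu, one_mul]
    _ = 1 := by rw [mul_assoc, h, hu]

theorem lift_self {i : σ.Index} {x : M} (hx : x ∈ σ.U i) : σ.lift i i x = 1 := by
  rw [lift, σ.liftR_self hx, σ.liftL_self hx, Matrix.fromBlocks_one]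

theorem lift_mul_lift {i j k : σ.Index} {x : M} (hi : x ∈ σ.U i) (hj : x ∈ σ.U j)
    (hk : x ∈ σ.U k) : σ.lift i j x * σ.lift j k x = σ.lift i k x := by
  simp [lift, Matrix.fromBlocks_multiply, σ.liftR_cocycle i j k x ⟨⟨hi, hj⟩, hk⟩,
    σ.liftL_cocycle i j k x ⟨⟨hi, hj⟩, hk⟩]

theorem lift_conjTranspose_mul_self {i j : σ.Index} {x : M} (hi : x ∈ σ.U i) (hj : x ∈ σ.U j) :
    (σ.lift i j x)ᴴ * σ.lift i j x = 1 := by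
  have hR := Matrix.mem_unitaryGroup_iff'.1
    (Matrix.mem_specialUnitaryGroup_iff.1 (σ.liftR_mem i j x ⟨hi, hj⟩)).1
  have hL := Matrix.mem_unitaryGroup_iff'.1
    (Matrix.mem_specialUnitaryGroup_iff.1 (σ.liftL_mem i j x ⟨hi, hj⟩)).1
  rw [Matrix.star_eq_conjTranspose] at hR hL
  simp [lift, Matrix.fromBlocks_conjTranspose, Matrix.fromBlocks_multiply, hR, hL]

/-- The vierbein spans the tangent space. -/
theorem sum_inner_frame_smul {i : σ.Index} {x : M} (hx : x ∈ σ.U i) (v : TangentSpace (𝓡 4) x) :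
    ∑ a, g.inner x v (σ.frame i a x) • σ.frame i a x = v := by
  have ho := σ.frame_orthonormal i x hx
  have hcoef : ∀ (c : Fin 4 → ℝ) (b : Fin 4),
      g.inner x (∑ a, c a • σ.frame i a x) (σ.frame i b x) = c b := fun c b => by
    simp [map_sum, ho]
  have hli : LinearIndependent ℝ fun a => σ.frame i a x := by
    rw [Fintype.linearIndependent_iff]
    intro c hc b
    rw [← hcoef c b, hc]
    simp
  have hcard : Fintype.card (Fin 4) = Module.finrank ℝ (TangentSpace (𝓡 4) x) := by
    change _ = Module.finrank ℝ E4
    simp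
  let e := basisOfLinearIndependentOfCardEqFinrank hli hcard
  have he : ∀ a, e a = σ.frame i a x := fun a => by simp [e]
  have hv := e.sum_repr v
  simp only [he] at hv
  have hc : ∀ b, g.inner x v (σ.frame i b x) = e.repr v b := fun b => by
    rw [← hcoef (fun a => e.repr v a) b, hv]
  simp only [hc]
  exact hv

/-- The matrix of `-i γ^μ A_μ` at `x`, in the vierbein over `U i`. -/
def symbol (A : OneForm M DoubleASM) (i : σ.Index) (x : M) : Matrix FullIdx FullIdx ℂ :=
  slashMatrix fun a => A x (σ.frame i a x)

theorem slashed_apply (A : OneForm M DoubleASM) (ψ : σ.smoothSpinors) {i : σ.Index} {x : M}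
    (hx : x ∈ σ.U i) :
    σ.slashed A ψ i x = σ.symbol A i x *ᵥ (ψ : σ.LocalSpinors) i x := by
  simp only [slashed, hx, if_true, symbol, slashMatrix, Matrix.smul_mulVec, Matrix.sum_mulVec,
    Matrix.mulVec_mulVec]

theorem slashed_apply_of_notMem (A : OneForm M DoubleASM) (ψ : σ.smoothSpinors) {i : σ.Index}
    {x : M} (hx : x ∉ σ.U i) : σ.slashed A ψ i x = 0 := by
  simp [slashed, hx]

/-- The transition functions of the spinor bundle intertwine the local matrices of `-i γ^μ A_μ`. -/
theorem lift_mul_symbol (A : OneForm M DoubleASM) {i j : σ.Index} {x : M} (hi : x ∈ σ.U i)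
    (hj : x ∈ σ.U j) : spinAct (σ.lift i j x) * σ.symbol A j x =
      σ.symbol A i x * spinAct (σ.lift i j x) := by
  let c : Fin 4 → Fin 4 → ℝ := fun a b => g.inner x (σ.frame j b x) (σ.frame i a x)
  -- the lift of the change of frame on the Dirac matrices
  have hγ : ∀ b, σ.lift i j x * diracMatrix b =
      (∑ a, (c a b : ℂ) • diracMatrix a) * σ.lift i j x := fun b => by
    have h := σ.lift_covers i j x ⟨hi, hj⟩ (σ.frame j b x)
    simpa [cliffordIn, σ.frame_orthonormal j x hj, lift, c] using h
  have hA : ∀ a, A x (σ.frame i a x) = ∑ b, c a b • (A x (σ.frame j b x) : DoubleASM) :=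
    fun a => by
      have h := congrArg (A x) (σ.sum_inner_frame_smul hj (σ.frame i a x))
      rw [map_sum] at h
      simp only [map_smul, g.symm x (σ.frame i a x)] at h
      exact h.symm
  have hspin : ∀ b, spinAct (σ.lift i j x) * spinAct (diracMatrix b) =
      ∑ a, c a b • (spinAct (diracMatrix a) * spinAct (σ.lift i j x)) := fun b => by
    rw [← spinAct_mul, hγ, spinAct_mul, ← spinActL_apply (∑ a, _), map_sum, Finset.sum_mul]
    refine Finset.sum_congr rfl fun a _ => ?_
    rw [map_smul, spinActL_apply, smul_mul_assoc]
    rfl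
  have hcomm : ∀ X, spinAct (σ.lift i j x) * rep X = rep X * spinAct (σ.lift i j x) :=
    fun X => spinAct_diag_mul_rep _ _ X
  simp only [symbol, slashMatrix, Matrix.mul_smul, Matrix.smul_mul]
  congr 1
  simp only [hA, rep_sum, rep_smul, Finset.mul_sum, Finset.sum_mul]
  simp only [← mul_assoc, hspin, Finset.sum_mul, Matrix.mul_smul, Matrix.smul_mul]
  rw [Finset.sum_comm]
  refine Finset.sum_congr rfl fun a _ => Finset.sum_congr rfl fun b _ => ?_
  rw [mul_assoc, hcomm, ← mul_assoc]

end SpinStructure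

end SpinorBundle

/-! ### Twisted commutators and free 1-forms -/

section FreeOneForms

variable {M : Type*} [TopologicalSpace M] [ChartedSpace E4 M] [IsManifold (𝓡 4) ∞ M]

namespace SpinStructure

variable {g : Metric M} (σ : SpinStructure g)

theorem contMDiffOn_spinAct_lift_mulVec (j i : σ.Index) (v : FullIdx → ℂ) :
    ContMDiffOn (𝓡 4) 𝓘(ℝ, FullIdx → ℂ) ∞ (fun y => spinAct (σ.lift j i y) *ᵥ v)
      (σ.U j ∩ σ.U i) := by
  have key : ∀ R L : Matrix (Fin 2) (Fin 2) ℂ, spinAct (Matrix.fromBlocks R 0 0 L) *ᵥ v =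
      spinAct (Matrix.fromBlocks R 0 0 0) *ᵥ v + spinAct (Matrix.fromBlocks 0 0 0 L) *ᵥ v :=
    fun R L => by
      have h : Matrix.fromBlocks R 0 0 L =
          Matrix.fromBlocks R 0 0 0 + Matrix.fromBlocks 0 0 0 L := by
        simp [Matrix.fromBlocks_add]
      rw [h, ← spinActL_apply, map_add, Matrix.add_mulVec]
      rfl
  let ℓR : Matrix (Fin 2) (Fin 2) ℂ →ₗ[ℝ] FullIdx → ℂ :=
    { toFun := fun R => spinAct (Matrix.fromBlocks R 0 0 0) *ᵥ v
      map_add' := fun R R' => by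
        rw [← Matrix.add_mulVec, ← spinActL_apply, ← spinActL_apply, ← spinActL_apply, ← map_add]
        simp [Matrix.fromBlocks_add]
      map_smul' := fun r R => by
        have h : Matrix.fromBlocks (r • R) 0 0 0 =
            (r : ℂ) • (Matrix.fromBlocks R 0 0 0 : Matrix SpinIdx SpinIdx ℂ) := by
          simp [Matrix.fromBlocks_smul]
        rw [h, ← spinActL_apply, map_smul, Matrix.smul_mulVec]
        rfl }
  let ℓL : Matrix (Fin 2) (Fin 2) ℂ →ₗ[ℝ] FullIdx → ℂ :=
    { toFun := fun L => spinAct (Matrix.fromBlocks 0 0 0 L) *ᵥ v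
      map_add' := fun R R' => by
        rw [← Matrix.add_mulVec, ← spinActL_apply, ← spinActL_apply, ← spinActL_apply, ← map_add]
        simp [Matrix.fromBlocks_add]
      map_smul' := fun r R => by
        have h : Matrix.fromBlocks 0 0 0 (r • R) =
            (r : ℂ) • (Matrix.fromBlocks 0 0 0 R : Matrix SpinIdx SpinIdx ℂ) := by
          simp [Matrix.fromBlocks_smul]
        rw [h, ← spinActL_apply, map_smul, Matrix.smul_mulVec]
        rfl }
  have h := ((clm ℓR).contMDiff.comp_contMDiffOn (σ.liftR_smooth j i)).add
    ((clm ℓL).contMDiff.comp_contMDiffOn (σ.liftL_smooth j i))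
  refine h.congr fun y _ => ?_
  exact key _ _

/-- Smooth spinor fields take arbitrary values at a given point. -/
theorem exists_smoothSpinors_apply_eq [T2Space M] {i : σ.Index} {x : M} (hx : x ∈ σ.U i)
    (v : FullIdx → ℂ) : ∃ ψ : σ.smoothSpinors, (ψ : σ.LocalSpinors) i x = v := by
  classical
  obtain ⟨f, -, hf⟩ := (SmoothBumpFunction.nhds_basis_tsupport (I := 𝓡 4) x).mem_iff.1
    ((σ.isOpen_U i).mem_nhds hx)
  have hf0 : ∀ y ∉ σ.U i, f y = 0 := fun y hy =>
    image_eq_zero_of_notMem_tsupport fun h => hy (hf h)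
  -- the section that is constantly `v` in the `i`-th trivialization, cut off by `f`
  let ψ : σ.LocalSpinors := fun j y =>
    if y ∈ σ.U j then f y • (spinAct (σ.lift j i y) *ᵥ v) else 0
  refine ⟨⟨ψ, fun j y hy => ?_, fun j y hy => by simp [ψ, hy], fun j k y hy => ?_⟩, ?_⟩
  · by_cases hyi : y ∈ σ.U i
    · have hU : σ.U j ∩ σ.U i ∈ nhds y :=
        ((σ.isOpen_U j).inter (σ.isOpen_U i)).mem_nhds ⟨hy, hyi⟩
      have h := (f.contMDiff.contMDiffOn.smul (σ.contMDiffOn_spinAct_lift_mulVec j i v)).contMDiffAt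
        hU
      refine (h.congr_of_eventuallyEq ?_).contMDiffWithinAt
      filter_upwards [hU] with z hz
      simp [ψ, hz.1]
    · have hU : (tsupport f)ᶜ ∈ nhds y :=
        (isClosed_tsupport f).isOpen_compl.mem_nhds fun h => hyi (hf h)
      refine ((contMDiffAt_const (c := 0)).congr_of_eventuallyEq ?_).contMDiffWithinAt
      filter_upwards [hU] with z hz
      simp [ψ, image_eq_zero_of_notMem_tsupport hz]
  · by_cases hyi : y ∈ σ.U i
    · simp only [ψ, hy.1, hy.2, if_true]
      rw [Matrix.mulVec_smul, Matrix.mulVec_mulVec, ← spinAct_mul,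
        σ.lift_mul_lift hy.1 hy.2 hyi]
    · simp [ψ, hf0 y hyi]
  · simp [ψ, hx, σ.lift_self hx, spinAct_one]

/-- The operator `-i γ^μ A_μ` determines the 1-form `A`. -/
theorem slashed_injective [T2Space M] : Function.Injective σ.slashed := by
  intro A B h
  refine OneForm.ext_apply fun x v => ?_
  obtain ⟨i, hx⟩ := σ.exists_mem_U x
  have hsymb : σ.symbol A i x = σ.symbol B i x := by
    refine Matrix.ext_of_mulVec_single fun k => ?_
    obtain ⟨ψ, hψ⟩ := σ.exists_smoothSpinors_apply_eq hx (Pi.single k 1)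
    have := congrFun (congrFun (congrFun h ψ) i) x
    rwa [σ.slashed_apply A ψ hx, σ.slashed_apply B ψ hx, hψ] at this
  have hfr := slashMatrix_injective hsymb
  rw [← σ.sum_inner_frame_smul hx v, map_sum, map_sum]
  refine Finset.sum_congr rfl fun a _ => ?_
  rw [map_smul, map_smul]
  exact congrArg _ (congrFun hfr a)

theorem spinAct_spinConnection_mul_rep (i : σ.Index) (x : M) (a : Fin 4) (b : DoubleASM) :
    spinAct (σ.spinConnection i x a) * rep b = rep b * spinAct (σ.spinConnection i x a) := by
  have h : ∀ c d, spinAct (diracMatrix c * diracMatrix d) * rep b =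
      rep b * spinAct (diracMatrix c * diracMatrix d) := fun c d => by
    rw [spinAct_mul, ← mul_assoc, rep_mul_diracMatrix, mul_assoc (spinAct _) (rep _),
      rep_mul_diracMatrix, Prod.swap_swap, mul_assoc]
  simp only [spinConnection, ← spinActL_apply, map_sum, map_smul, Finset.sum_mul, Finset.mul_sum,
    Matrix.smul_mul, Matrix.mul_smul]
  simp only [spinActL_apply, h]

/-- The twisted commutator with `b` is the multiplication operator `-i γ^μ ∂_μ b`: the derivatives
of the spinor cancel because the Dirac matrices intertwine `b` and its twist, and the spin connection
drops out because it preserves the chirality. -/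
theorem twistedCommutator_eq (b : TwistedAlgebra M) :
    σ.twistedCommutator b = σ.slashed (OneForm.d b b.contMDiff) := by
  funext ψ i x
  by_cases hx : x ∈ σ.U i
  swap
  · rw [σ.slashed_apply_of_notMem _ _ hx]
    simp [twistedCommutator, act, dirac, hx]
  have hψ : MDifferentiableAt (𝓡 4) 𝓘(ℝ, FullIdx → ℂ) ((ψ : σ.LocalSpinors) i) x :=
    ((ψ.2.1 i).contMDiffAt ((σ.isOpen_U i).mem_nhds hx)).mdifferentiableAt (by simp)
  have hb : MDifferentiableAt (𝓡 4) 𝓘(ℝ, DoubleASM) b x := b.contMDiff.mdifferentiableAt (by simp)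
  have hd : ∀ v, diffAt (σ.act b ψ i) x v = rep (b x) *ᵥ diffAt ((ψ : σ.LocalSpinors) i) x v +
      rep (diffAt b x v) *ᵥ (ψ : σ.LocalSpinors) i x := fun v => diffAt_bilin repB hb hψ v
  have hdirac : ∀ φ : σ.LocalSpinors, σ.dirac φ i x = (-Complex.I) • ∑ a,
      spinAct (diracMatrix a) *ᵥ (diffAt (φ i) x (σ.frame i a x) +
        spinAct (σ.spinConnection i x a) *ᵥ φ i x) := fun φ => by
    simp only [dirac, hx, if_true]
    rfl
  have hact : ∀ (c : M → DoubleASM) (φ : σ.LocalSpinors), σ.act c φ i x = rep (c x) *ᵥ φ i x :=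
    fun _ _ => rfl
  rw [σ.slashed_apply _ _ hx]
  simp only [twistedCommutator, Pi.sub_apply, hact, hdirac, hd, symbol, slashMatrix]
  rw [Matrix.mulVec_smul, ← smul_sub, Matrix.smul_mulVec, Matrix.mulVec_sum,
    ← Finset.sum_sub_distrib, Matrix.sum_mulVec]
  congr 1
  refine Finset.sum_congr rfl fun a _ => ?_
  have htw : ∀ w, rep (twist b x) *ᵥ (spinAct (diracMatrix a) *ᵥ w) =
      spinAct (diracMatrix a) *ᵥ (rep (b x) *ᵥ w) := fun w => by
    rw [Matrix.mulVec_mulVec, Matrix.mulVec_mulVec]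
    exact congrArg (· *ᵥ w) (rep_mul_diracMatrix _ a)
  have hω : ∀ w, spinAct (σ.spinConnection i x a) *ᵥ (rep (b x) *ᵥ w) =
      rep (b x) *ᵥ (spinAct (σ.spinConnection i x a) *ᵥ w) := fun w => by
    rw [Matrix.mulVec_mulVec, Matrix.mulVec_mulVec, σ.spinAct_spinConnection_mul_rep]
  rw [htw, hω, ← Matrix.mulVec_mulVec, ← Matrix.mulVec_sub, Matrix.mulVec_add, OneForm.d_apply]
  congr 1
  abel

theorem act_slashed (a : TwistedAlgebra M) (A : OneForm M DoubleASM) (ψ : σ.smoothSpinors) :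
    σ.act a (σ.slashed A ψ) =
      σ.slashed (A.bilin mulB (fun x => (a x).swap) (contMDiff_swap a.contMDiff)) ψ := by
  funext i x
  by_cases hx : x ∈ σ.U i
  · rw [σ.slashed_apply _ _ hx, act, σ.slashed_apply _ _ hx, Matrix.mulVec_mulVec, symbol,
      rep_mul_slashMatrix]
    rfl
  · rw [σ.slashed_apply_of_notMem _ _ hx, act, σ.slashed_apply_of_notMem _ _ hx,
      Matrix.mulVec_zero]

theorem slashed_sum {ι : Type*} (s : Finset ι) (A : ι → OneForm M DoubleASM)
    (ψ : σ.smoothSpinors) : σ.slashed (OneForm.sum s A) ψ = ∑ k ∈ s, σ.slashed (A k) ψ := by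
  funext i x
  rw [Finset.sum_apply, Finset.sum_apply]
  by_cases hx : x ∈ σ.U i
  · simp only [σ.slashed_apply _ _ hx, symbol, OneForm.sum_apply, slashMatrix_sum,
      Matrix.sum_mulVec]
  · simp only [σ.slashed_apply_of_notMem _ _ hx, Finset.sum_const_zero]

/-- The free 1-form `∑ a_k [D̸, b_k]_ρ` is `-i γ^μ A_μ` with `A = ∑ ρ(a_k) db_k`. -/
theorem sum_act_twistedCommutator {n : ℕ} (a b : Fin n → TwistedAlgebra M) :
    (fun ψ => ∑ k, σ.act (a k) (σ.twistedCommutator (b k) ψ)) =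
      σ.slashed (OneForm.sum Finset.univ fun k =>
        (OneForm.d (b k) (b k).contMDiff).bilin mulB (fun x => (a k x).swap)
          (contMDiff_swap (a k).contMDiff)) := by
  funext ψ
  simp only [slashed_sum, twistedCommutator_eq, act_slashed]

/-- On a compact manifold the free 1-forms are exactly the operators `-i γ^μ A_μ`. -/
theorem isFreeOneForm_iff [CompactSpace M] [T2Space M] (T : σ.Operator) :
    σ.IsFreeOneForm T ↔ ∃ A, T = σ.slashed A := by
  constructor
  · rintro ⟨n, a, b, rfl⟩
    exact ⟨_, σ.sum_act_twistedCommutator a b⟩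
  · rintro ⟨A, rfl⟩
    obtain ⟨n, f, h, hf, hh, hA⟩ := A.exists_eq_sum_diffAt_smul
    -- With `b_k = h_k 1` the form `ρ(a_k) db_k` is `f_k dh_k` for `a_k = ρ(f_k)`.
    let L : ℝ →L[ℝ] DoubleASM := clm (LinearMap.toSpanSingleton ℝ DoubleASM 1)
    let a : Fin n → TwistedAlgebra M := fun k => ⟨fun x => (f k x).swap, contMDiff_swap (hf k)⟩
    let b : Fin n → TwistedAlgebra M := fun k => ⟨fun x => L (h k x), L.contMDiff.comp (hh k)⟩
    refine ⟨n, a, b, .trans ?_ (σ.sum_act_twistedCommutator a b).symm⟩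
    congr 1
    refine OneForm.ext_apply fun x v => ?_
    rw [hA, OneForm.sum_apply]
    refine Finset.sum_congr rfl fun k _ => ?_
    have hd : diffAt (fun y => L (h k y)) x v = L (diffAt (h k) x v) :=
      diffAt_clm_comp L ((hh k).mdifferentiableAt (by simp)) v
    have hL : ∀ r, L r = r • (1 : DoubleASM) := fun r => rfl
    change _ = mulB (f k x).swap.swap (diffAt (fun y => L (h k y)) x v)
    rw [hd, hL, mulB_apply, Prod.swap_swap, mul_smul_comm, mul_one]

end SpinStructure

end FreeOneForms

/-! ### The Riemannian volume -/

section Volume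
variable {M : Type*} [TopologicalSpace M] [ChartedSpace E4 M] [IsManifold (𝓡 4) ∞ M]
  (g : Metric M)

/-- The coordinate vector fields used for the Gram matrix are those of the tangent bundle's
trivialization. -/
theorem mfderiv_extChartAt_symm_eq (c : M) {y : E4} (hy : y ∈ (extChartAt (𝓡 4) c).target) :
    mfderiv 𝓘(ℝ, E4) (𝓡 4) (extChartAt (𝓡 4) c).symm y =
      chartFrame c ((extChartAt (𝓡 4) c).symm y) := by
  have hx : (extChartAt (𝓡 4) c).symm y ∈ (chartAt E4 c).source := by
    simpa using (extChartAt (𝓡 4) c).map_target hy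
  rw [chartFrame, TangentBundle.symmL_trivializationAt hx, (extChartAt (𝓡 4) c).right_inv hy,
    ModelWithCorners.range_eq_univ, mfderivWithin_univ]

theorem gram_apply (c : M) {y : E4} (hy : y ∈ (extChartAt (𝓡 4) c).target) (μ ν : Fin 4) :
    gram g c y μ ν = g.inner ((extChartAt (𝓡 4) c).symm y)
      (chartFrame c _ (EuclideanSpace.single μ (1 : ℝ)))
      (chartFrame c _ (EuclideanSpace.single ν (1 : ℝ))) := by
  simp only [gram, Matrix.of_apply, mfderiv_extChartAt_symm_eq c hy]
  rfl

theorem continuousOn_inner {X Y : ∀ x : M, TangentSpace (𝓡 4) x} {s : Set M}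
    (hX : ContMDiffOn (𝓡 4) (𝓡 4).tangent ∞ (fun x => (⟨x, X x⟩ : TangentBundle (𝓡 4) M)) s)
    (hY : ContMDiffOn (𝓡 4) (𝓡 4).tangent ∞ (fun x => (⟨x, Y x⟩ : TangentBundle (𝓡 4) M)) s) :
    ContinuousOn (fun x => g.inner x (X x) (Y x)) s := by
  have h : ContMDiffOn (𝓡 4) ((𝓡 4).prod 𝓘(ℝ)) ∞ (fun m => Bundle.TotalSpace.mk' ℝ
      (E := Bundle.Trivial M ℝ) m (g.inner m (X m) (Y m))) s :=
    ContMDiffOn.clm_bundle_apply₂ (F₁ := E4) (F₂ := E4) g.contMDiff.contMDiffOn hX hY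
  intro x hx
  exact (Bundle.contMDiffWithinAt_totalSpace.1 (h x hx)).2.continuousWithinAt

theorem continuousOn_det_gram (c : M) :
    ContinuousOn (fun y => (gram g c y).det) (extChartAt (𝓡 4) c).target := by
  have h : ContinuousOn (gram g c) (extChartAt (𝓡 4) c).target := by
    refine continuousOn_pi.2 fun μ => continuousOn_pi.2 fun ν => ?_
    have hs := continuousOn_inner g (contMDiffOn_chartFrame c (EuclideanSpace.single μ (1 : ℝ)))
      (contMDiffOn_chartFrame c (EuclideanSpace.single ν (1 : ℝ)))
    refine (hs.comp (continuousOn_extChartAt_symm c) fun y hy => ?_).congr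
      fun y hy => gram_apply g c hy μ ν
    simpa using (extChartAt (𝓡 4) c).map_target hy
  exact (continuous_id.matrix_det).comp_continuousOn h

theorem det_gram_pos (c : M) {y : E4} (hy : y ∈ (extChartAt (𝓡 4) c).target) :
    0 < (gram g c y).det := by
  refine (Matrix.PosDef.of_dotProduct_mulVec_pos ?_ fun w hw => ?_).det_pos
  · ext μ ν
    simp only [Matrix.conjTranspose_apply, gram_apply g c hy, star_trivial]
    exact g.symm _ _ _
  · set x := (extChartAt (𝓡 4) c).symm y
    let u : E4 := ∑ μ, w μ • EuclideanSpace.single μ (1 : ℝ)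
    have hu : u = WithLp.toLp 2 w := by
      ext i
      simp [u, Finset.sum_apply, Pi.single_apply]
    have hinj : chartFrame c x u ≠ 0 := fun h0 => by
      have hx : x ∈ (trivializationAt E4 (TangentSpace (𝓡 4)) c).baseSet := by
        change (extChartAt (𝓡 4) c).symm y ∈ _
        simpa using (extChartAt (𝓡 4) c).map_target hy
      have h1 := Bundle.Trivialization.continuousLinearMapAt_symmL (R := ℝ)
        (trivializationAt E4 (TangentSpace (𝓡 4)) c) hx u
      change _ = _ at h1
      rw [show (trivializationAt E4 (TangentSpace (𝓡 4)) c).symmL ℝ x u = 0 from h0,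
        map_zero] at h1
      refine hw ?_
      ext i
      have := congrArg (fun z : E4 => z i) (h1.trans hu)
      simpa using this.symm
    have hq : star w ⬝ᵥ (gram g c y).mulVec w =
        g.inner x (chartFrame c x u) (chartFrame c x u) := by
      simp only [u, map_sum, map_smul, sum_apply, smul_apply,
        dotProduct, Matrix.mulVec, gram_apply g c hy, star_trivial, smul_eq_mul, Finset.mul_sum]
      rw [Finset.sum_comm]
      refine Finset.sum_congr rfl fun μ _ => Finset.sum_congr rfl fun ν _ => ?_
      ring
    rw [hq]
    exact g.pos x _ hinj

/-- The density of the Riemannian volume with respect to the Lebesgue measure of a chart. -/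
abbrev gramDensity (c : M) (y : E4) : ENNReal := ENNReal.ofReal (Real.sqrt (gram g c y).det)

theorem aemeasurable_gramDensity (c : M) : AEMeasurable (gramDensity g c)
    ((volume : Measure E4).restrict (extChartAt (𝓡 4) c).target) :=
  (((continuousOn_det_gram g c).sqrt).aemeasurable
    (isOpen_extChartAt_target c).measurableSet).ennreal_ofReal

variable [MeasurableSpace M] [BorelSpace M]

theorem chartVolume_apply (c : M) {s : Set M} (hs : MeasurableSet s) :
    chartVolume g c s = (((volume : Measure E4).restrict
      (extChartAt (𝓡 4) c).target).withDensity (gramDensity g c))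
        ((extChartAt (𝓡 4) c).symm ⁻¹' s) := by
  refine Measure.map_apply_of_aemeasurable (AEMeasurable.mono_ac ?_
    (withDensity_absolutelyContinuous _ _)) hs
  exact (continuousOn_extChartAt_symm c).aemeasurable (isOpen_extChartAt_target c).measurableSet

theorem chartVolume_lt_top [T2Space M] (c : M) {K : Set M} (hK : IsCompact K)
    (hKc : K ⊆ (extChartAt (𝓡 4) c).source) : chartVolume g c K < ⊤ := by
  set T := (extChartAt (𝓡 4) c).target
  set P := (extChartAt (𝓡 4) c).symm ⁻¹' K
  have hT : MeasurableSet T := (isOpen_extChartAt_target c).measurableSet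
  -- the compact image of `K` in the chart
  let Q := extChartAt (𝓡 4) c '' K
  have hQ : IsCompact Q := hK.image_of_continuousOn ((continuousOn_extChartAt c).mono hKc)
  have hQT : Q ⊆ T := by
    rintro _ ⟨x, hx, rfl⟩
    exact (extChartAt (𝓡 4) c).map_source (hKc hx)
  have hPQ : P ∩ T = Q := by
    ext y
    constructor
    · rintro ⟨hy, hyT⟩
      exact ⟨_, hy, (extChartAt (𝓡 4) c).right_inv hyT⟩
    · rintro ⟨x, hx, rfl⟩
      refine ⟨?_, (extChartAt (𝓡 4) c).map_source (hKc hx)⟩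
      change (extChartAt (𝓡 4) c).symm _ ∈ K
      rwa [(extChartAt (𝓡 4) c).left_inv (hKc hx)]
  have hint : IntegrableOn (fun y => Real.sqrt (gram g c y).det) Q (volume : Measure E4) :=
    ((continuousOn_det_gram g c).sqrt.mono hQT).integrableOn_compact hQ
  rw [chartVolume_apply g c hK.measurableSet, withDensity_apply' , Measure.restrict_restrict' hT,
    hPQ]
  exact hint.lintegral_lt_top

/-- The Riemannian volume of a compact manifold is finite. -/
theorem isFiniteMeasure_riemannianVolume [CompactSpace M] [T2Space M] :
    IsFiniteMeasure (riemannianVolume g) := by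
  have hsub : ∀ c : M, tsupport (chartPartition M c) ⊆ (extChartAt (𝓡 4) c).source := fun c => by
    rw [extChartAt_source]
    exact (SmoothPartitionOfUnity.exists_isSubordinate_chartAt_source (𝓡 4) M).choose_spec c
  let ν : M → Measure M := fun c =>
    (chartVolume g c).withDensity fun x => ENNReal.ofReal (chartPartition M c x)
  have hν : ∀ c, ν c Set.univ ≤ chartVolume g c (tsupport (chartPartition M c)) := fun c => by
    have hK : MeasurableSet (tsupport (chartPartition M c)) := (isClosed_tsupport _).measurableSet
    rw [← lintegral_indicator_one hK, withDensity_apply _ .univ, Measure.restrict_univ]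
    refine lintegral_mono fun x => ?_
    by_cases hx : x ∈ tsupport (chartPartition M c)
    · rw [Set.indicator_of_mem hx]
      exact ENNReal.ofReal_le_one.2 ((chartPartition M).le_one c x)
    · rw [Set.indicator_of_notMem hx, image_eq_zero_of_notMem_tsupport hx, ENNReal.ofReal_zero]
  refine ⟨?_⟩
  have hfin := (chartPartition M).locallyFinite.finite_nonempty_of_compact
  change Measure.sum ν Set.univ < ⊤
  rw [Measure.sum_apply _ .univ, tsum_eq_sum (s := hfin.toFinset)]
  · exact ENNReal.sum_lt_top.2 fun c _ => (hν c).trans_lt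
      (chartVolume_lt_top g c (isClosed_tsupport _).isCompact (hsub c))
  · intro c hc
    have h0 : Function.support (chartPartition M c) = ∅ := by
      simpa [Set.not_nonempty_iff_eq_empty] using hc
    refine le_antisymm ((hν c).trans ?_) zero_le
    rw [tsupport, h0, closure_empty, measure_empty]

/-- The Riemannian volume of a nonempty open set is positive. -/
theorem isOpenPosMeasure_riemannianVolume [CompactSpace M] [T2Space M] :
    (riemannianVolume g).IsOpenPosMeasure := by
  refine ⟨fun O hO ⟨x, hx⟩ h0 => ?_⟩
  obtain ⟨c, hc⟩ := (chartPartition M).exists_pos_of_mem (Set.mem_univ x)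
  have hcs : Function.support (chartPartition M c) ⊆ (extChartAt (𝓡 4) c).source := by
    rw [extChartAt_source]
    exact subset_closure.trans
      ((SmoothPartitionOfUnity.exists_isSubordinate_chartAt_source (𝓡 4) M).choose_spec c)
  have hcont : Continuous (chartPartition M c) := (chartPartition M c).contMDiff.continuous
  have h1 : ((chartVolume g c).withDensity
      fun x => ENNReal.ofReal (chartPartition M c x)) O = 0 :=
    le_antisymm ((Measure.le_sum _ c O).trans h0.le) zero_le
  rw [withDensity_apply_eq_zero hcont.measurable.ennreal_ofReal] at h1
  set S := {x | ENNReal.ofReal (chartPartition M c x) ≠ 0} ∩ O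
  have hS : IsOpen S := by
    refine IsOpen.inter ?_ hO
    exact isOpen_ne.preimage (ENNReal.continuous_ofReal.comp hcont)
  have hxS : x ∈ S := ⟨by simpa using hc, hx⟩
  rw [chartVolume_apply g c hS.measurableSet, withDensity_apply_eq_zero'
    (aemeasurable_gramDensity g c), Measure.restrict_apply'
    (isOpen_extChartAt_target c).measurableSet] at h1
  have hset : {y | gramDensity g c y ≠ 0} ∩ (extChartAt (𝓡 4) c).symm ⁻¹' S ∩
      (extChartAt (𝓡 4) c).target =
        (extChartAt (𝓡 4) c).target ∩ (extChartAt (𝓡 4) c).symm ⁻¹' S := by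
    ext y
    constructor
    · rintro ⟨⟨-, h⟩, h'⟩
      exact ⟨h', h⟩
    · rintro ⟨h', h⟩
      exact ⟨⟨(ENNReal.ofReal_pos.2 (Real.sqrt_pos.2 (det_gram_pos g c h'))).ne', h⟩, h'⟩
  rw [hset] at h1
  have hopen := (continuousOn_extChartAt_symm (I := 𝓡 4) c).isOpen_inter_preimage
    (isOpen_extChartAt_target (I := 𝓡 4) c) hS
  have hxc : x ∈ (extChartAt (𝓡 4) c).source := hcs hc.ne'
  refine (hopen.measure_pos volume ⟨extChartAt (𝓡 4) c x, ?_⟩).ne' h1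
  refine ⟨(extChartAt (𝓡 4) c).map_source hxc, ?_⟩
  change (extChartAt (𝓡 4) c).symm _ ∈ S
  rwa [(extChartAt (𝓡 4) c).left_inv hxc]

end Volume

/-! ### Selfadjoint 1-forms -/

section Selfadjointness

theorem continuousAt_star_dotProduct {X n : Type*} [TopologicalSpace X] [Fintype n]
    {u v : X → n → ℂ} {x : X} (hu : ContinuousAt u x) (hv : ContinuousAt v x) :
    ContinuousAt (fun y => star (u y) ⬝ᵥ v y) x := by
  simp only [dotProduct, Pi.star_apply]
  exact tendsto_finsetSum _ fun i _ => ((continuousAt_pi.1 hu i).star).mul (continuousAt_pi.1 hv i)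

variable {M : Type*} [TopologicalSpace M] [ChartedSpace E4 M] [IsManifold (𝓡 4) ∞ M]

theorem star_real_smul (r : ℝ) (X : DoubleASM) : star (r • X) = r • star X := by
  have hm : ∀ m : Matrix (Fin 3) (Fin 3) ℂ, star (r • m) = r • star m := fun m => by
    ext i j
    simp [Matrix.star_apply]
  exact Prod.ext (Prod.ext (star_smul _ _) (Prod.ext (Quaternion.star_smul _ _) (hm _)))
    (Prod.ext (star_smul _ _) (Prod.ext (Quaternion.star_smul _ _) (hm _)))

namespace SpinStructure

variable {g : Metric M} (σ : SpinStructure g)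

/-- The operator `-i γ^μ A_μ` preserves the smooth spinor fields. -/
theorem slashed_mem_smoothSpinors (A : OneForm M DoubleASM) (ψ : σ.smoothSpinors) :
    σ.slashed A ψ ∈ σ.smoothSpinors := by
  refine ⟨fun i => ?_, fun i x hx => σ.slashed_apply_of_notMem A ψ hx, fun i j x hx => ?_⟩
  · have hterm : ∀ a, ContMDiffOn (𝓡 4) 𝓘(ℝ, FullIdx → ℂ) ∞
        (fun x => spinAct (diracMatrix a) *ᵥ (rep (A x (σ.frame i a x)) *ᵥ
          (ψ : σ.LocalSpinors) i x)) (σ.U i) := fun a =>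
      (clm ((spinAct (diracMatrix a)).mulVecLin.restrictScalars ℝ)).contMDiff.comp_contMDiffOn
        (contMDiffOn_bilin repB (A.contMDiffOn_apply (σ.frame_smooth i a)) (ψ.2.1 i))
    have hsum : ContMDiffOn (𝓡 4) 𝓘(ℝ, FullIdx → ℂ) ∞ (fun x => ∑ a, spinAct (diracMatrix a) *ᵥ
        (rep (A x (σ.frame i a x)) *ᵥ (ψ : σ.LocalSpinors) i x)) (σ.U i) :=
      contMDiffOn_finsetSum fun a _ => hterm a
    have hI : ContDiff ℝ ∞ fun v : FullIdx → ℂ => (-Complex.I) • v := contDiff_id.const_smul _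
    refine (hI.contMDiff.comp_contMDiffOn hsum).congr fun x hx => ?_
    simp only [slashed, hx, if_true]
    rfl
  · rw [σ.slashed_apply _ _ hx.1, σ.slashed_apply _ _ hx.2, ψ.2.2.2 i j x hx,
      Matrix.mulVec_mulVec, Matrix.mulVec_mulVec, σ.lift_mul_symbol A hx.1 hx.2]

/-- The product of a real function and a smooth spinor field. -/
def fnSmul (f : M → ℝ) (hf : ContMDiff (𝓡 4) 𝓘(ℝ, ℝ) ∞ f) (ψ : σ.smoothSpinors) :
    σ.smoothSpinors :=
  ⟨fun i x => f x • (ψ : σ.LocalSpinors) i x, fun i => hf.contMDiffOn.smul (ψ.2.1 i),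
    fun i x hx => by simp [ψ.2.2.1 i x hx],
    fun i j x hx => by
      change f x • (ψ : σ.LocalSpinors) i x = _ *ᵥ (f x • (ψ : σ.LocalSpinors) j x)
      rw [ψ.2.2.2 i j x hx, Matrix.mulVec_smul]⟩

theorem fnSmul_apply {f : M → ℝ} (hf : ContMDiff (𝓡 4) 𝓘(ℝ, ℝ) ∞ f) (ψ : σ.smoothSpinors)
    (i : σ.Index) (x : M) : (σ.fnSmul f hf ψ : σ.LocalSpinors) i x =
      f x • (ψ : σ.LocalSpinors) i x := rfl

/-- The fibrewise hermitian product may be computed in any member of the cover, because the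
transition functions are unitary. -/
theorem fibreInner_eq (ψ φ : σ.smoothSpinors) {i : σ.Index} {x : M} (hx : x ∈ σ.U i) :
    σ.fibreInner ψ φ x = star ((ψ : σ.LocalSpinors) i x) ⬝ᵥ (φ : σ.LocalSpinors) i x := by
  have hk : x ∈ σ.U (σ.exists_mem_U x).choose := (σ.exists_mem_U x).choose_spec
  rw [fibreInner, ψ.2.2.2 _ i x ⟨hk, hx⟩, φ.2.2.2 _ i x ⟨hk, hx⟩, Matrix.star_mulVec,
    ← Matrix.dotProduct_mulVec, Matrix.mulVec_mulVec, spinAct_conjTranspose, ← spinAct_mul,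
    σ.lift_conjTranspose_mul_self hk hx, spinAct_one, Matrix.one_mulVec]

theorem continuous_fibreInner (ψ φ : σ.smoothSpinors) : Continuous (σ.fibreInner ψ φ) := by
  refine continuous_iff_continuousAt.2 fun x => ?_
  obtain ⟨i, hx⟩ := σ.exists_mem_U x
  have hU := (σ.isOpen_U i).mem_nhds hx
  have hψ := (ψ.2.1 i).continuousOn.continuousAt hU
  have hφ := (φ.2.1 i).continuousOn.continuousAt hU
  have h : ContinuousAt (fun y => star ((ψ : σ.LocalSpinors) i y) ⬝ᵥ
      (φ : σ.LocalSpinors) i y) x := by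
    exact continuousAt_star_dotProduct hψ hφ
  refine h.congr ?_
  filter_upwards [hU] with y hy
  exact (σ.fibreInner_eq ψ φ hy).symm

variable [CompactSpace M] [T2Space M] [MeasurableSpace M] [BorelSpace M]

/-- A selfadjoint operator `-i γ^μ A_μ` is symmetric in every fibre: the fibrewise defect is a
continuous function that is orthogonal to all smooth functions. -/
theorem fibreInner_slashed_of_isSelfadjoint {A : OneForm M DoubleASM}
    (hA : σ.IsSelfadjoint (σ.slashed A)) (ψ φ : σ.smoothSpinors) (x : M) :
    σ.fibreInner (σ.slashed A ψ) φ x = σ.fibreInner ψ (σ.slashed A φ) x := by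
  have := isFiniteMeasure_riemannianVolume g
  have := isOpenPosMeasure_riemannianVolume g
  let T : σ.smoothSpinors → σ.smoothSpinors := fun χ => ⟨_, σ.slashed_mem_smoothSpinors A χ⟩
  have hint : ∀ χ ξ : σ.smoothSpinors, Integrable (σ.fibreInner χ ξ) (riemannianVolume g) :=
    fun χ ξ => (σ.continuous_fibreInner χ ξ).integrable_of_hasCompactSupport
      (HasCompactSupport.of_compactSpace _)
  let F : M → ℂ := fun x => σ.fibreInner (T ψ) φ x - σ.fibreInner ψ (T φ) x
  have hF : Continuous F :=
    (σ.continuous_fibreInner (T ψ) φ).sub (σ.continuous_fibreInner ψ (T φ))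
  have h0 : ∀ᵐ x ∂(riemannianVolume g), F x = 0 := by
    refine ae_eq_zero_of_integral_contMDiff_smul_eq_zero (𝓡 4)
      ((hint (T ψ) φ).sub (hint ψ (T φ))).locallyIntegrable fun f hf _ => ?_
    have h1 : ∀ x, f x • F x = σ.fibreInner (T (σ.fnSmul f hf ψ)) φ x -
        σ.fibreInner (σ.fnSmul f hf ψ) (T φ) x := fun x => by
      obtain ⟨i, hx⟩ := σ.exists_mem_U x
      have hTf : (T (σ.fnSmul f hf ψ) : σ.LocalSpinors) i x =
          f x • (T ψ : σ.LocalSpinors) i x := by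
        change σ.slashed A _ i x = f x • σ.slashed A ψ i x
        rw [σ.slashed_apply _ _ hx, σ.slashed_apply _ _ hx, fnSmul_apply, Matrix.mulVec_smul]
      simp only [F]
      rw [σ.fibreInner_eq _ _ hx, σ.fibreInner_eq _ _ hx, σ.fibreInner_eq _ _ hx,
        σ.fibreInner_eq _ _ hx, hTf, fnSmul_apply, star_smul, star_smul, smul_dotProduct,
        smul_dotProduct, ← smul_sub, star_trivial (f x)]
    simp only [h1]
    rw [integral_sub (hint _ _) (hint _ _), sub_eq_zero]
    exact hA (σ.fnSmul f hf ψ) φ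
  have h2 := (hF.ae_eq_iff_eq _ continuous_const).1 h0
  exact sub_eq_zero.1 (congrFun h2 x)

/-- The operator `-i γ^μ A_μ` is selfadjoint if and only if `A = -ρ(A^*)`. -/
theorem isSelfadjoint_slashed_iff (A : OneForm M DoubleASM) :
    σ.IsSelfadjoint (σ.slashed A) ↔
      ∀ (x : M) (v : TangentSpace (𝓡 4) x),
        (A x v : DoubleASM) = -(star (A x v : DoubleASM)).swap := by
  constructor
  · intro hA x v
    obtain ⟨i, hx⟩ := σ.exists_mem_U x
    have hherm : (σ.symbol A i x).IsHermitian := by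
      ext k l
      obtain ⟨ψ, hψ⟩ := σ.exists_smoothSpinors_apply_eq hx (Pi.single k 1)
      obtain ⟨φ, hφ⟩ := σ.exists_smoothSpinors_apply_eq hx (Pi.single l 1)
      have h := σ.fibreInner_slashed_of_isSelfadjoint hA ψ φ x
      have h1 := σ.fibreInner_eq ⟨_, σ.slashed_mem_smoothSpinors A ψ⟩ φ hx
      have h2 := σ.fibreInner_eq ψ ⟨_, σ.slashed_mem_smoothSpinors A φ⟩ hx
      simp only [σ.slashed_apply _ _ hx, hψ, hφ] at h1 h2
      rw [h1, h2] at h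
      simpa [Matrix.star_mulVec] using h
    have hframe := (isHermitian_slashMatrix_iff _).1 hherm
    -- the condition is real-linear in the tangent vector
    let J : DoubleASM →ₗ[ℝ] DoubleASM :=
      { toFun := fun X => X + (star X).swap
        map_add' := fun X Y => by
          rw [star_add, Prod.swap_add]
          abel
        map_smul' := fun r X => by
          rw [star_real_smul, RingHom.id_apply, smul_add]
          rfl }
    have hJ : ∀ X, J X = 0 ↔ X = -(star X).swap := fun X => add_eq_zero_iff_eq_neg
    rw [← hJ, ← σ.sum_inner_frame_smul hx v, map_sum, map_sum]
    refine Finset.sum_eq_zero fun a _ => ?_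
    rw [map_smul]
    refine (map_smul J _ _).trans ?_
    rw [(hJ _).2 (hframe a), smul_zero]
  · intro hA ψ φ
    refine integral_congr_ae (.of_forall fun x => ?_)
    obtain ⟨i, hx⟩ := σ.exists_mem_U x
    have hherm : (σ.symbol A i x).IsHermitian :=
      (isHermitian_slashMatrix_iff _).2 fun a => hA x _
    have h1 := σ.fibreInner_eq ⟨_, σ.slashed_mem_smoothSpinors A ψ⟩ φ hx
    have h2 := σ.fibreInner_eq ψ ⟨_, σ.slashed_mem_smoothSpinors A φ⟩ hx
    refine h1.trans (Eq.trans ?_ h2.symm)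
    simp only [σ.slashed_apply _ _ hx]
    rw [Matrix.star_mulVec, hherm.eq, Matrix.dotProduct_mulVec]

end SpinStructure

end Selfadjointness

/-! ### Fields at a point -/

/-- The pointwise relation between a value `X` of the algebra-valued form and the values of the
fields. -/
def FieldRel (g₁ g₂ g₃ : ℝ) (X : DoubleASM) (a w : ℝ) (h : Matrix (Fin 3) (Fin 3) ℂ) (B : ℝ)
    (W : Matrix (Fin 2) (Fin 2) ℂ) (V : Matrix (Fin 3) (Fin 3) ℂ) (v0 : ℝ) : Prop :=
  X.1.1 = a - Complex.I * (g₁ / 2) * B ∧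
  X.2.1 = -a - Complex.I * (g₁ / 2) * B ∧
  quatMatrix X.2.2.1 = (w : ℂ) • (1 : Matrix (Fin 2) (Fin 2) ℂ) - (Complex.I * (g₂ / 2)) • W ∧
  quatMatrix X.1.2.1 = -(w : ℂ) • (1 : Matrix (Fin 2) (Fin 2) ℂ) - (Complex.I * (g₂ / 2)) • W ∧
  X.1.2.2 = h + Complex.I • ((v0 : ℂ) • (1 : Matrix (Fin 3) (Fin 3) ℂ) + (g₃ / 2 : ℂ) • V) ∧
  X.2.2.2 = -h + Complex.I • ((v0 : ℂ) • (1 : Matrix (Fin 3) (Fin 3) ℂ) + (g₃ / 2 : ℂ) • V)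

section Pointwise

variable {g₁ g₂ g₃ : ℝ} {X : DoubleASM} {a w B v0 a' w' B' v0' : ℝ}
  {h V h' V' : Matrix (Fin 3) (Fin 3) ℂ} {W W' : Matrix (Fin 2) (Fin 2) ℂ}

theorem trace_eq_zero_of_smul_mem_su {n : ℕ} {Y : Matrix (Fin n) (Fin n) ℂ}
    (hY : Complex.I • Y ∈ su n) : Y.trace = 0 := by
  have := hY.2
  rw [Matrix.trace_smul, smul_eq_zero] at this
  exact this.resolve_left Complex.I_ne_zero

theorem isHermitian_of_smul_mem_su {n : ℕ} {Y : Matrix (Fin n) (Fin n) ℂ}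
    (hY : Complex.I • Y ∈ su n) : Yᴴ = Y := by
  have h := hY.1
  rw [Matrix.conjTranspose_smul, Complex.star_def, Complex.conj_I, neg_smul, neg_inj] at h
  exact smul_right_injective _ Complex.I_ne_zero h

/-- The values of the fields are determined by the algebra element. -/
theorem FieldRel.unique (hg₁ : g₁ ≠ 0) (hg₂ : g₂ ≠ 0) (hg₃ : g₃ ≠ 0)
    (hW : W.trace = 0) (hW' : W'.trace = 0) (hV : V.trace = 0) (hV' : V'.trace = 0)
    (H : FieldRel g₁ g₂ g₃ X a w h B W V v0) (H' : FieldRel g₁ g₂ g₃ X a' w' h' B' W' V' v0') :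
    a = a' ∧ w = w' ∧ h = h' ∧ B = B' ∧ W = W' ∧ V = V' ∧ v0 = v0' := by
  obtain ⟨e1, -, e3, -, e5, e6⟩ := H
  obtain ⟨f1, -, f3, -, f5, f6⟩ := H'
  rw [e1] at f1
  rw [e3] at f3
  rw [e5] at f5
  rw [e6] at f6
  have hg₁' : (g₁ : ℂ) ≠ 0 := by exact_mod_cast hg₁
  have hg₂' : (g₂ : ℂ) ≠ 0 := by exact_mod_cast hg₂
  have hg₃' : (g₃ : ℂ) ≠ 0 := by exact_mod_cast hg₃
  have ha : a = a' := by simpa using congrArg Complex.re f1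
  have hB : B = B' := by
    have := congrArg Complex.im f1
    simp at this
    exact this.resolve_right hg₁
  have hw : w = w' := by
    have := congrArg Matrix.trace f3
    simp only [Matrix.trace_sub, Matrix.trace_smul, hW, hW', Matrix.trace_one] at this
    simpa using this
  have hWW : W = W' := by
    rw [hw, sub_right_inj] at f3
    refine smul_right_injective _ (mul_ne_zero Complex.I_ne_zero ?_) f3
    exact div_ne_zero hg₂' two_ne_zero
  have hh : h = h' := by
    have := congrArg₂ (fun P Q => (1 / 2 : ℂ) • (P - Q)) f5 f6
    convert this using 1 <;> module
  rw [hh, add_right_inj] at f5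
  have hS := smul_right_injective _ Complex.I_ne_zero f5
  have hv : v0 = v0' := by
    have := congrArg Matrix.trace hS
    simp only [Matrix.trace_add, Matrix.trace_smul, hV, hV', Matrix.trace_one] at this
    simpa using this
  have hVV : V = V' := by
    rw [hv, add_right_inj] at hS
    exact smul_right_injective _ (div_ne_zero hg₃' two_ne_zero) hS
  exact ⟨ha, hw, hh, hB, hWW, hVV, hv⟩

/-- The fields determine the algebra element. -/
theorem FieldRel.unique_left {Y : DoubleASM} (H : FieldRel g₁ g₂ g₃ X a w h B W V v0)
    (H' : FieldRel g₁ g₂ g₃ Y a w h B W V v0) : X = Y := by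
  obtain ⟨e1, e2, e3, e4, e5, e6⟩ := H
  obtain ⟨f1, f2, f3, f4, f5, f6⟩ := H'
  exact Prod.ext (Prod.ext (e1.trans f1.symm) (Prod.ext (quatMatrix_injective (e4.trans f4.symm))
    (e5.trans f5.symm))) (Prod.ext (e2.trans f2.symm)
    (Prod.ext (quatMatrix_injective (e3.trans f3.symm)) (e6.trans f6.symm)))

theorem quatMatrix_neg (q : ℍ[ℝ]) : quatMatrix (-q) = -quatMatrix q := by
  rw [← neg_one_smul ℝ, quatMatrix_smul, neg_one_smul]

/-- Elements built from selfadjoint fields satisfy the selfadjointness condition. -/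
theorem FieldRel.eq_neg_swap_star (hh : h.IsHermitian) (hW : Complex.I • W ∈ su 2)
    (hV : Complex.I • V ∈ su 3) (H : FieldRel g₁ g₂ g₃ X a w h B W V v0) :
    X = -(star X).swap := by
  have hWh := isHermitian_of_smul_mem_su hW
  have hVh := isHermitian_of_smul_mem_su hV
  obtain ⟨e1, e2, e3, e4, e5, e6⟩ := H
  have hc : X.1.1 = -star X.2.1 := by
    rw [e1, e2]
    apply Complex.ext <;> simp
  have hq : quatMatrix X.1.2.1 = -(quatMatrix X.2.2.1)ᴴ := by
    rw [e3, e4, Matrix.conjTranspose_sub, Matrix.conjTranspose_smul, Matrix.conjTranspose_smul, hWh,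
      Matrix.conjTranspose_one]
    simp only [star_mul', Complex.star_def, Complex.conj_I, Complex.conj_ofReal, map_div₀,
      map_ofNat]
    module
  have hm : X.1.2.2 = -(X.2.2.2)ᴴ := by
    rw [e5, e6, Matrix.conjTranspose_add, Matrix.conjTranspose_smul, Matrix.conjTranspose_add,
      Matrix.conjTranspose_smul, Matrix.conjTranspose_smul, hVh, Matrix.conjTranspose_one,
      Matrix.conjTranspose_neg, hh.eq]
    simp only [Complex.star_def, Complex.conj_I, Complex.conj_ofReal, map_div₀, map_ofNat]
    module
  have hq1 : X.1.2.1 = -star X.2.2.1 := quatMatrix_injective (by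
    rw [hq, quatMatrix_neg, quatMatrix_star])
  have hc' : X.2.1 = -star X.1.1 := by rw [hc, star_neg, star_star, neg_neg]
  have hq' : X.2.2.1 = -star X.1.2.1 := by rw [hq1, star_neg, star_star, neg_neg]
  have hm' : X.2.2.2 = -(X.1.2.2)ᴴ := by
    rw [hm, Matrix.conjTranspose_neg, Matrix.conjTranspose_conjTranspose, neg_neg]
  exact Prod.ext (Prod.ext hc (Prod.ext hq1 hm)) (Prod.ext hc' (Prod.ext hq' hm'))

/-- The trace vanishes precisely if the trace part of the `M₃(ℂ)`-valued component is tied to the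
hypercharge field. -/
theorem FieldRel.trace_rep_eq_zero_iff (hW : W.trace = 0) (hV : V.trace = 0)
    (H : FieldRel g₁ g₂ g₃ X a w h B W V v0) : (rep X).trace = 0 ↔ v0 = g₁ / 6 * B := by
  obtain ⟨e1, e2, e3, e4, e5, e6⟩ := H
  have ht : (rep X).trace = 48 * Complex.I * ((v0 - g₁ / 6 * B : ℝ) : ℂ) := by
    rw [trace_rep, e1, e2, e3, e4, e5, e6]
    simp only [Matrix.trace_add, Matrix.trace_sub, Matrix.trace_smul, Matrix.trace_neg, hW, hV,
      Matrix.trace_one, Fintype.card_fin, smul_eq_mul, star_sub, star_neg, star_mul',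
      Complex.star_def, Complex.conj_I, Complex.conj_ofReal, map_div₀, map_ofNat]
    push_cast
    ring
  rw [ht, mul_eq_zero, Complex.ofReal_eq_zero, sub_eq_zero]
  exact or_iff_right (mul_ne_zero (by norm_num) Complex.I_ne_zero)

/-- The inverse of `quatMatrix` on its range, extended to all matrices. -/
def matrixQuat : Matrix (Fin 2) (Fin 2) ℂ →ₗ[ℝ] ℍ[ℝ] where
  toFun Y := ⟨(Y 0 0).re, (Y 0 0).im, (Y 0 1).re, (Y 0 1).im⟩
  map_add' Y Z := by ext <;> simp <;> rfl
  map_smul' r Y := by ext <;> simp <;> rfl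

theorem quatMatrix_matrixQuat {Y : Matrix (Fin 2) (Fin 2) ℂ} (h1 : Y 1 1 = star (Y 0 0))
    (h0 : Y 1 0 = -star (Y 0 1)) : quatMatrix (matrixQuat Y) = Y := by
  have h : quatMatrix (matrixQuat Y) = !![⟨(Y 0 0).re, (Y 0 0).im⟩, ⟨(Y 0 1).re, (Y 0 1).im⟩;
    ⟨-(Y 0 1).re, (Y 0 1).im⟩, ⟨(Y 0 0).re, -(Y 0 0).im⟩] := rfl
  rw [h]
  ext i j
  fin_cases i <;> fin_cases j <;> (apply Complex.ext <;> simp [h1, h0])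

theorem quatMatrix_matrixQuat_of_mem_su (r s : ℝ) (hW : Complex.I • W ∈ su 2) :
    quatMatrix (matrixQuat ((r : ℂ) • (1 : Matrix (Fin 2) (Fin 2) ℂ) - (Complex.I * s) • W)) =
      (r : ℂ) • (1 : Matrix (Fin 2) (Fin 2) ℂ) - (Complex.I * s) • W := by
  have hWh := isHermitian_of_smul_mem_su hW
  have hWt := trace_eq_zero_of_smul_mem_su hW
  rw [Matrix.trace_fin_two] at hWt
  have h11 : W 1 1 = -star (W 0 0) := by
    have h00 : star (W 0 0) = W 0 0 := congrFun (congrFun hWh 0) 0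
    rw [h00]
    linear_combination hWt
  have h10 : W 1 0 = star (W 0 1) := (congrFun (congrFun hWh 1) 0).symm
  refine quatMatrix_matrixQuat ?_ ?_
  · simp [h11]
  · simp [h10]

end Pointwise

section Reconstruction

variable (g₁ g₂ g₃ : ℝ)

/-- The values `(a, w, g, B, W, V, V⁰)` of the fields. -/
abbrev FieldValues := ℝ × ℝ × Matrix (Fin 3) (Fin 3) ℂ × ℝ × Matrix (Fin 2) (Fin 2) ℂ ×
  Matrix (Fin 3) (Fin 3) ℂ × ℝ

/-- The algebra element with given values of the fields. -/
def ofFieldValues : FieldValues →ₗ[ℝ] DoubleASM where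
  toFun p :=
    ((p.1 - Complex.I * (g₁ / 2) * p.2.2.2.1,
      matrixQuat (((-p.2.1 : ℝ) : ℂ) • (1 : Matrix (Fin 2) (Fin 2) ℂ) -
        (Complex.I * (g₂ / 2 : ℝ)) • p.2.2.2.2.1),
      p.2.2.1 + Complex.I • ((p.2.2.2.2.2.2 : ℂ) • (1 : Matrix (Fin 3) (Fin 3) ℂ) +
        (g₃ / 2 : ℂ) • p.2.2.2.2.2.1)),
     (-p.1 - Complex.I * (g₁ / 2) * p.2.2.2.1,
      matrixQuat ((p.2.1 : ℂ) • (1 : Matrix (Fin 2) (Fin 2) ℂ) -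
        (Complex.I * (g₂ / 2 : ℝ)) • p.2.2.2.2.1),
      -p.2.2.1 + Complex.I • ((p.2.2.2.2.2.2 : ℂ) • (1 : Matrix (Fin 3) (Fin 3) ℂ) +
        (g₃ / 2 : ℂ) • p.2.2.2.2.2.1)))
  map_add' p q := by
    simp only [Prod.fst_add, Prod.snd_add]
    refine Prod.ext (Prod.ext ?_ (Prod.ext ?_ ?_)) (Prod.ext ?_ (Prod.ext ?_ ?_))
    · simp only [Prod.fst_add]
      push_cast
      ring
    · simp only [Prod.fst_add, Prod.snd_add]
      rw [← map_add]
      congr 1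
      push_cast
      module
    · simp only [Prod.fst_add, Prod.snd_add]
      push_cast
      module
    · simp only [Prod.fst_add, Prod.snd_add]
      push_cast
      ring
    · simp only [Prod.fst_add, Prod.snd_add]
      rw [← map_add]
      congr 1
      push_cast
      module
    · simp only [Prod.snd_add]
      push_cast
      module
  map_smul' r p := by
    have hr : ∀ {n : ℕ} (Y : Matrix (Fin n) (Fin n) ℂ), r • Y = (r : ℂ) • Y := fun Y => rfl
    simp only [Prod.smul_fst, Prod.smul_snd, RingHom.id_apply, smul_eq_mul]
    refine Prod.ext (Prod.ext ?_ (Prod.ext ?_ ?_)) (Prod.ext ?_ (Prod.ext ?_ ?_))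
    · simp only [Prod.smul_fst, Complex.real_smul]
      push_cast
      ring
    · simp only [Prod.smul_fst, Prod.smul_snd]
      rw [← map_smul]
      congr 1
      simp only [hr]
      push_cast
      module
    · simp only [Prod.smul_fst, Prod.smul_snd, hr]
      push_cast
      module
    · simp only [Prod.smul_fst, Prod.smul_snd, Complex.real_smul]
      push_cast
      ring
    · simp only [Prod.smul_fst, Prod.smul_snd]
      rw [← map_smul]
      congr 1
      simp only [hr]
      push_cast
      module
    · simp only [Prod.smul_snd, hr]
      push_cast
      module

theorem fieldRel_ofFieldValues (a w : ℝ) (h : Matrix (Fin 3) (Fin 3) ℂ) (B : ℝ)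
    {W : Matrix (Fin 2) (Fin 2) ℂ} (V : Matrix (Fin 3) (Fin 3) ℂ) (v0 : ℝ)
    (hW : Complex.I • W ∈ su 2) :
    FieldRel g₁ g₂ g₃ (ofFieldValues g₁ g₂ g₃ (a, w, h, B, W, V, v0)) a w h B W V v0 := by
  refine ⟨rfl, rfl, ?_, ?_, rfl, rfl⟩
  · refine (quatMatrix_matrixQuat_of_mem_su w (g₂ / 2) hW).trans ?_
    push_cast
    rfl
  · refine (quatMatrix_matrixQuat_of_mem_su (-w) (g₂ / 2) hW).trans ?_
    push_cast
    rfl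

/-- The values of the fields of an algebra element that satisfies the selfadjointness condition. -/
def toFieldValues : DoubleASM →ₗ[ℝ] FieldValues where
  toFun X :=
    (X.1.1.re, X.2.2.1.re, (1 / 2 : ℂ) • (X.1.2.2 + (X.1.2.2)ᴴ), -(2 / g₁) * X.1.1.im,
      (Complex.I * (2 / g₂)) • (quatMatrix X.2.2.1 - (X.2.2.1.re : ℂ) • 1),
      (2 / g₃ : ℂ) • ((-Complex.I / 2) • (X.1.2.2 - (X.1.2.2)ᴴ) -
        ((X.1.2.2.trace.im / 3 : ℝ) : ℂ) • 1),
      X.1.2.2.trace.im / 3)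
  map_add' X Y := by
    simp only [Prod.fst_add, Prod.snd_add, Prod.mk_add_mk, Prod.mk.injEq, quatMatrix_add,
      Matrix.conjTranspose_add, Matrix.trace_add, Complex.add_re, Complex.add_im, Quaternion.re_add]
    refine ⟨trivial, trivial, by module, by ring, ?_, ?_, by ring⟩ <;> push_cast <;> module
  map_smul' r X := by
    have hr : ∀ {n : ℕ} (Y : Matrix (Fin n) (Fin n) ℂ), r • Y = (r : ℂ) • Y := fun Y => rfl
    simp only [Prod.smul_fst, Prod.smul_snd, Prod.smul_mk, Prod.mk.injEq, quatMatrix_smul, hr,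
      Matrix.conjTranspose_smul, Matrix.trace_smul, Complex.real_smul, Complex.re_ofReal_mul,
      Complex.im_ofReal_mul, Quaternion.re_smul, smul_eq_mul, RingHom.id_apply, Complex.star_def,
      Complex.conj_ofReal]
    refine ⟨trivial, trivial, by module, by ring, ?_, ?_, by ring⟩ <;> push_cast <;> module

variable {g₁ g₂ g₃}

theorem fieldRel_toFieldValues (hg₁ : g₁ ≠ 0) (hg₂ : g₂ ≠ 0) (hg₃ : g₃ ≠ 0) {X : DoubleASM}
    (hX : X = -(star X).swap) :
    FieldRel g₁ g₂ g₃ X (toFieldValues g₁ g₂ g₃ X).1 (toFieldValues g₁ g₂ g₃ X).2.1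
      (toFieldValues g₁ g₂ g₃ X).2.2.1 (toFieldValues g₁ g₂ g₃ X).2.2.2.1
      (toFieldValues g₁ g₂ g₃ X).2.2.2.2.1 (toFieldValues g₁ g₂ g₃ X).2.2.2.2.2.1
      (toFieldValues g₁ g₂ g₃ X).2.2.2.2.2.2 := by
  have hg₁' : (g₁ : ℂ) ≠ 0 := by exact_mod_cast hg₁
  have hg₂' : (g₂ : ℂ) ≠ 0 := by exact_mod_cast hg₂
  have hg₃' : (g₃ : ℂ) ≠ 0 := by exact_mod_cast hg₃
  have hI := Complex.I_mul_I
  have hc : X.2.1 = -star X.1.1 := congrArg (fun Y : DoubleASM => Y.2.1) hX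
  have hq : X.1.2.1 = -star X.2.2.1 := congrArg (fun Y : DoubleASM => Y.1.2.1) hX
  have hm : X.2.2.2 = -(X.1.2.2)ᴴ := congrArg (fun Y : DoubleASM => Y.2.2.2) hX
  have hW : (Complex.I * (g₂ / 2 : ℂ)) • (Complex.I * (2 / g₂) : ℂ) •
      (quatMatrix X.2.2.1 - (X.2.2.1.re : ℂ) • 1) =
        -(quatMatrix X.2.2.1 - (X.2.2.1.re : ℂ) • 1) := by
    rw [smul_smul, ← neg_one_smul ℂ (quatMatrix X.2.2.1 - _)]
    congr 1
    field_simp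
    linear_combination hI
  have hV : ∀ Y : Matrix (Fin 3) (Fin 3) ℂ, (g₃ / 2 : ℂ) • (2 / g₃ : ℂ) • Y = Y := fun Y => by
    rw [smul_smul]
    convert one_smul ℂ Y using 2
    field_simp
  have hanti : Complex.I • (-Complex.I / 2) • (X.1.2.2 - (X.1.2.2)ᴴ) =
      (1 / 2 : ℂ) • (X.1.2.2 - (X.1.2.2)ᴴ) := by
    rw [smul_smul]
    congr 1
    linear_combination (-1 / 2 : ℂ) * hI
  simp only [FieldRel, toFieldValues, LinearMap.coe_mk, AddHom.coe_mk]
  refine ⟨?_, ?_, ?_, ?_, ?_, ?_⟩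
  · apply Complex.ext <;> simp
    field_simp
  · rw [hc]
    apply Complex.ext <;> simp
    field_simp
  · rw [hW]
    module
  · rw [hW, hq, quatMatrix_neg, quatMatrix_star]
    ext i j
    fin_cases i <;> fin_cases j <;> (apply Complex.ext <;> simp [quatMatrix])
  · rw [hV, add_sub_cancel, hanti]
    module
  · rw [hV, add_sub_cancel, hanti, hm]
    module

theorem toFieldValues_isHermitian (X : DoubleASM) :
    (toFieldValues g₁ g₂ g₃ X).2.2.1.IsHermitian := by
  change ((1 / 2 : ℂ) • (X.1.2.2 + (X.1.2.2)ᴴ))ᴴ = (1 / 2 : ℂ) • (X.1.2.2 + (X.1.2.2)ᴴ)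
  rw [Matrix.conjTranspose_smul, Matrix.conjTranspose_add, Matrix.conjTranspose_conjTranspose,
    add_comm]
  simp

theorem toFieldValues_W_mem_su (X : DoubleASM) :
    Complex.I • (toFieldValues g₁ g₂ g₃ X).2.2.2.2.1 ∈ su 2 := by
  change Complex.I • (Complex.I * (2 / g₂)) • (quatMatrix X.2.2.1 - (X.2.2.1.re : ℂ) • 1) ∈ su 2
  constructor
  · ext i j
    fin_cases i <;> fin_cases j <;>
      simp [quatMatrix, Complex.ext_iff]
  · rw [Matrix.trace_smul, Matrix.trace_smul, Matrix.trace_sub, Matrix.trace_smul,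
      Matrix.trace_fin_two]
    have : quatMatrix X.2.2.1 0 0 + quatMatrix X.2.2.1 1 1 = 2 * (X.2.2.1.re : ℂ) := by
      apply Complex.ext <;> simp [quatMatrix]
      ring
    rw [this]
    simp only [Matrix.trace_one, Fintype.card_fin, smul_eq_mul]
    push_cast
    ring

theorem toFieldValues_V_mem_su (X : DoubleASM) :
    Complex.I • (toFieldValues g₁ g₂ g₃ X).2.2.2.2.2.1 ∈ su 3 := by
  change Complex.I • (2 / g₃ : ℂ) • ((-Complex.I / 2) • (X.1.2.2 - (X.1.2.2)ᴴ) -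
        ((X.1.2.2.trace.im / 3 : ℝ) : ℂ) • (1 : Matrix (Fin 3) (Fin 3) ℂ)) ∈ su 3
  constructor
  · simp only [Matrix.conjTranspose_smul, Matrix.conjTranspose_sub, Matrix.conjTranspose_one,
      Matrix.conjTranspose_conjTranspose, Complex.star_def, Complex.conj_I, Complex.conj_ofReal,
      map_div₀, map_ofNat, map_neg]
    module
  · have ht : X.1.2.2.trace - star X.1.2.2.trace = 2 * Complex.I * (X.1.2.2.trace.im : ℂ) := by
      apply Complex.ext <;> simp
      ring
    rw [Matrix.trace_smul, Matrix.trace_smul, Matrix.trace_sub, Matrix.trace_smul, Matrix.trace_sub,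
      Matrix.trace_conjTranspose, ht, Matrix.trace_smul, Matrix.trace_one]
    simp only [smul_eq_mul, Fintype.card_fin]
    push_cast
    linear_combination (-Complex.I * (2 / g₃) * X.1.2.2.trace.im) * Complex.I_mul_I

end Reconstruction

/-! ### Fields of an algebra-valued 1-form -/

section Fields

variable {M : Type*} [TopologicalSpace M] [ChartedSpace E4 M] [IsManifold (𝓡 4) ∞ M]

/-- The pairing of two 1-forms. -/
def OneForm.prod {V W : Type*} [NormedAddCommGroup V] [NormedSpace ℝ V] [NormedAddCommGroup W]
    [NormedSpace ℝ W] (A : OneForm M V) (B : OneForm M W) : OneForm M (V × W) :=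
  A.postcomp (ContinuousLinearMap.inl ℝ V W) + B.postcomp (ContinuousLinearMap.inr ℝ V W)

theorem OneForm.prod_apply {V W : Type*} [NormedAddCommGroup V] [NormedSpace ℝ V]
    [NormedAddCommGroup W] [NormedSpace ℝ W] (A : OneForm M V) (B : OneForm M W) (x : M)
    (v : TangentSpace (𝓡 4) x) : A.prod B x v = (A x v, B x v) := by
  refine (OneForm.add_apply _ _ x v).trans ?_
  simp

-- Instance search does not find this for the whole nested product within its default limits.
instance finiteDimensional_fieldValues : FiniteDimensional ℝ FieldValues := by
  have (n : ℕ) : FiniteDimensional ℝ (Matrix (Fin n) (Fin n) ℂ) := inferInstance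
  have : FiniteDimensional ℝ (Matrix (Fin 2) (Fin 2) ℂ × Matrix (Fin 3) (Fin 3) ℂ × ℝ) :=
    inferInstance
  have : FiniteDimensional ℝ
      (ℝ × Matrix (Fin 2) (Fin 2) ℂ × Matrix (Fin 3) (Fin 3) ℂ × ℝ) := inferInstance
  have : FiniteDimensional ℝ
      (ℝ × Matrix (Fin 3) (Fin 3) ℂ × ℝ × Matrix (Fin 2) (Fin 2) ℂ ×
        Matrix (Fin 3) (Fin 3) ℂ × ℝ) := inferInstance
  infer_instance

variable (g₁ g₂ g₃ : ℝ)

/-- The algebra-valued 1-form with given fields. -/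
def ofFields (F : Fields M) (V0 : OneForm M ℝ) : OneForm M DoubleASM :=
  (F.a.prod (F.w.prod (F.g.prod (F.B.prod (F.W.prod (F.V.prod V0)))))).postcomp
    (clm (ofFieldValues g₁ g₂ g₃))

theorem ofFields_apply (F : Fields M) (V0 : OneForm M ℝ) (x : M) (v : TangentSpace (𝓡 4) x) :
    ofFields g₁ g₂ g₃ F V0 x v = ofFieldValues g₁ g₂ g₃
      (F.a x v, F.w x v, F.g x v, F.B x v, F.W x v, F.V x v, V0 x v) := by
  simp only [ofFields, OneForm.postcomp_apply, OneForm.prod_apply]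
  rfl

theorem hasFields_iff (A : OneForm M DoubleASM) (F : Fields M) (V0 : OneForm M ℝ) :
    HasFields g₁ g₂ g₃ A F V0 ↔ ∀ (x : M) (v : TangentSpace (𝓡 4) x),
      FieldRel g₁ g₂ g₃ (A x v) (F.a x v) (F.w x v) (F.g x v) (F.B x v) (F.W x v) (F.V x v)
        (V0 x v) := Iff.rfl

theorem hasFields_ofFields (F : Fields M) (V0 : OneForm M ℝ) :
    HasFields g₁ g₂ g₃ (ofFields g₁ g₂ g₃ F V0) F V0 := by
  rw [hasFields_iff]
  intro x v
  rw [ofFields_apply]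
  exact fieldRel_ofFieldValues g₁ g₂ g₃ _ _ _ _ _ _ (F.W_mem x v)

/-- The component `p` of the values of the fields of an algebra-valued 1-form. -/
def component {V : Type*} [NormedAddCommGroup V] [NormedSpace ℝ V] (p : FieldValues →ₗ[ℝ] V)
    (A : OneForm M DoubleASM) : OneForm M V :=
  A.postcomp (clm (p ∘ₗ toFieldValues g₁ g₂ g₃))

/-- The fields of an algebra-valued 1-form. They reproduce the form if it satisfies `A = -ρ(A^*)`,
but are defined for every form. -/
def toFields (A : OneForm M DoubleASM) : Fields M where
  a := component g₁ g₂ g₃ (.fst ℝ _ _) A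
  w := component g₁ g₂ g₃ (.fst ℝ _ _ ∘ₗ .snd ℝ _ _) A
  g := component g₁ g₂ g₃ (.fst ℝ _ _ ∘ₗ .snd ℝ _ _ ∘ₗ .snd ℝ _ _) A
  B := component g₁ g₂ g₃ (.fst ℝ _ _ ∘ₗ .snd ℝ _ _ ∘ₗ .snd ℝ _ _ ∘ₗ .snd ℝ _ _) A
  W := component g₁ g₂ g₃
    (.fst ℝ _ _ ∘ₗ .snd ℝ _ _ ∘ₗ .snd ℝ _ _ ∘ₗ .snd ℝ _ _ ∘ₗ .snd ℝ _ _) A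
  V := component g₁ g₂ g₃
    (.fst ℝ _ _ ∘ₗ .snd ℝ _ _ ∘ₗ .snd ℝ _ _ ∘ₗ .snd ℝ _ _ ∘ₗ .snd ℝ _ _ ∘ₗ .snd ℝ _ _) A
  g_selfadjoint x v := toFieldValues_isHermitian (g₁ := g₁) (g₂ := g₂) (g₃ := g₃) (A x v)
  W_mem x v := toFieldValues_W_mem_su (g₁ := g₁) (g₂ := g₂) (g₃ := g₃) (A x v)
  V_mem x v := toFieldValues_V_mem_su (g₁ := g₁) (g₂ := g₂) (g₃ := g₃) (A x v)

/-- The trace part `V⁰` of an algebra-valued 1-form. -/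
def toTracePart (A : OneForm M DoubleASM) : OneForm M ℝ :=
  component g₁ g₂ g₃
    (.snd ℝ _ _ ∘ₗ .snd ℝ _ _ ∘ₗ .snd ℝ _ _ ∘ₗ .snd ℝ _ _ ∘ₗ .snd ℝ _ _ ∘ₗ .snd ℝ _ _) A

variable {g₁ g₂ g₃}

theorem hasFields_toFields (hg₁ : g₁ ≠ 0) (hg₂ : g₂ ≠ 0) (hg₃ : g₃ ≠ 0) {A : OneForm M DoubleASM}
    (hA : ∀ (x : M) (v : TangentSpace (𝓡 4) x),
      (A x v : DoubleASM) = -(star (A x v : DoubleASM)).swap) :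
    HasFields g₁ g₂ g₃ A (toFields g₁ g₂ g₃ A) (toTracePart g₁ g₂ g₃ A) :=
  fun x v => fieldRel_toFieldValues hg₁ hg₂ hg₃ (hA x v)

theorem HasFields.unique (hg₁ : g₁ ≠ 0) (hg₂ : g₂ ≠ 0) (hg₃ : g₃ ≠ 0) {A : OneForm M DoubleASM}
    {F F' : Fields M} {V0 V0' : OneForm M ℝ} (H : HasFields g₁ g₂ g₃ A F V0)
    (H' : HasFields g₁ g₂ g₃ A F' V0') : F = F' ∧ V0 = V0' := by
  have key := fun x v => FieldRel.unique hg₁ hg₂ hg₃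
    (trace_eq_zero_of_smul_mem_su (F.W_mem x v)) (trace_eq_zero_of_smul_mem_su (F'.W_mem x v))
    (trace_eq_zero_of_smul_mem_su (F.V_mem x v)) (trace_eq_zero_of_smul_mem_su (F'.V_mem x v))
    ((hasFields_iff _ _ _ _ _ _).1 H x v) ((hasFields_iff _ _ _ _ _ _).1 H' x v)
  exact ⟨Fields.ext (OneForm.ext_apply fun x v => (key x v).1)
    (OneForm.ext_apply fun x v => (key x v).2.1) (OneForm.ext_apply fun x v => (key x v).2.2.1)
    (OneForm.ext_apply fun x v => (key x v).2.2.2.1)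
    (OneForm.ext_apply fun x v => (key x v).2.2.2.2.1)
    (OneForm.ext_apply fun x v => (key x v).2.2.2.2.2.1),
    OneForm.ext_apply fun x v => (key x v).2.2.2.2.2.2⟩

theorem HasFields.unique_left {A A' : OneForm M DoubleASM} {F : Fields M} {V0 : OneForm M ℝ}
    (H : HasFields g₁ g₂ g₃ A F V0) (H' : HasFields g₁ g₂ g₃ A' F V0) : A = A' :=
  OneForm.ext_apply fun x v => FieldRel.unique_left (H x v) (H' x v)

theorem HasFields.eq_neg_swap_star {A : OneForm M DoubleASM} {F : Fields M} {V0 : OneForm M ℝ}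
    (H : HasFields g₁ g₂ g₃ A F V0) (x : M) (v : TangentSpace (𝓡 4) x) :
    (A x v : DoubleASM) = -(star (A x v : DoubleASM)).swap :=
  FieldRel.eq_neg_swap_star (F.g_selfadjoint x v) (F.W_mem x v) (F.V_mem x v) (H x v)

theorem HasFields.isUnimodular_slashed_iff [T2Space M] {g : Metric M} (σ : SpinStructure g)
    {A : OneForm M DoubleASM} {F : Fields M} {V0 : OneForm M ℝ}
    (H : HasFields g₁ g₂ g₃ A F V0) :
    σ.IsUnimodular (σ.slashed A) ↔ V0 = (g₁ / 6) • F.B := by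
  have htr : ∀ (x : M) (v : TangentSpace (𝓡 4) x),
      (rep (A x v)).trace = 0 ↔ V0 x v = g₁ / 6 * F.B x v := fun x v =>
    FieldRel.trace_rep_eq_zero_iff (trace_eq_zero_of_smul_mem_su (F.W_mem x v))
      (trace_eq_zero_of_smul_mem_su (F.V_mem x v)) (H x v)
  constructor
  · rintro ⟨A', hA', ht⟩
    obtain rfl := σ.slashed_injective hA'
    exact OneForm.ext_apply fun x v => (htr x v).1 (ht x v)
  · rintro rfl
    exact ⟨A, rfl, fun x v => (htr x v).2 rfl⟩

end Fields

end TwistedSM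

end

theorem mainTheorem3 {M : Type*} [TopologicalSpace M] [ChartedSpace TwistedSM.E4 M]
    [IsManifold (𝓡 4) ∞ M] [CompactSpace M] [T2Space M] [MeasurableSpace M] [BorelSpace M]
    (g : TwistedSM.Metric M) (σ : TwistedSM.SpinStructure g)
    (g₁ g₂ g₃ : ℝ) (hg₁ : g₁ ≠ 0) (hg₂ : g₂ ≠ 0) (hg₃ : g₃ ≠ 0) :
    -- the components of a free 1-form are well defined
    (∀ T : σ.Operator, σ.IsFreeOneForm T →
      ∃! A : TwistedSM.OneForm M TwistedSM.DoubleASM, T = σ.slashed A) ∧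
    -- selfadjoint free 1-forms, and the unimodularity condition on them
    (∀ T : σ.Operator, σ.IsFreeOneForm T → σ.IsSelfadjoint T →
      (∃! p : TwistedSM.Fields M × TwistedSM.OneForm M ℝ,
        ∃ A, T = σ.slashed A ∧ TwistedSM.HasFields g₁ g₂ g₃ A p.1 p.2) ∧
      ∀ (A : TwistedSM.OneForm M TwistedSM.DoubleASM) (F : TwistedSM.Fields M)
        (V0 : TwistedSM.OneForm M ℝ), T = σ.slashed A → TwistedSM.HasFields g₁ g₂ g₃ A F V0 →
        (σ.IsUnimodular T ↔ V0 = (g₁ / 6) • F.B)) ∧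
    -- unimodular selfadjoint free 1-forms are parametrized by the fields
    (∀ T : σ.Operator, σ.IsFreeOneForm T → σ.IsSelfadjoint T → σ.IsUnimodular T →
      ∃! F : TwistedSM.Fields M,
        ∃ A, T = σ.slashed A ∧ TwistedSM.HasFields g₁ g₂ g₃ A F ((g₁ / 6) • F.B)) ∧
    -- all values of the fields occur, each for exactly one 1-form
    (∀ F : TwistedSM.Fields M, ∃! T : σ.Operator,
      (σ.IsFreeOneForm T ∧ σ.IsSelfadjoint T ∧ σ.IsUnimodular T) ∧
        ∃ A, T = σ.slashed A ∧ TwistedSM.HasFields g₁ g₂ g₃ A F ((g₁ / 6) • F.B)) := by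
  refine ⟨?_, ?_, ?_, ?_⟩
  · intro T hT
    obtain ⟨A, rfl⟩ := (σ.isFreeOneForm_iff T).1 hT
    exact ⟨A, rfl, fun A' hA' => σ.slashed_injective hA'.symm⟩
  · intro T hT hsa
    obtain ⟨A, rfl⟩ := (σ.isFreeOneForm_iff T).1 hT
    have hF := TwistedSM.hasFields_toFields hg₁ hg₂ hg₃ ((σ.isSelfadjoint_slashed_iff A).1 hsa)
    refine ⟨⟨(_, _), ⟨A, rfl, hF⟩, ?_⟩, ?_⟩
    · rintro ⟨F', V0'⟩ ⟨A', hA', hF'⟩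
      obtain rfl := σ.slashed_injective hA'
      have h := TwistedSM.HasFields.unique hg₁ hg₂ hg₃ hF' hF
      exact Prod.ext h.1 h.2
    · intro A' F V0 hA' hF'
      obtain rfl := σ.slashed_injective hA'
      exact TwistedSM.HasFields.isUnimodular_slashed_iff σ hF'
  · intro T hT hsa huni
    obtain ⟨A, rfl⟩ := (σ.isFreeOneForm_iff T).1 hT
    have hF := TwistedSM.hasFields_toFields hg₁ hg₂ hg₃ ((σ.isSelfadjoint_slashed_iff A).1 hsa)
    have hV := (TwistedSM.HasFields.isUnimodular_slashed_iff σ hF).1 huni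
    rw [hV] at hF
    refine ⟨_, ⟨A, rfl, hF⟩, ?_⟩
    rintro F' ⟨A', hA', hF'⟩
    obtain rfl := σ.slashed_injective hA'
    exact (TwistedSM.HasFields.unique hg₁ hg₂ hg₃ hF' hF).1
  · intro F
    have hF := TwistedSM.hasFields_ofFields g₁ g₂ g₃ F ((g₁ / 6) • F.B)
    refine ⟨σ.slashed _, ⟨⟨(σ.isFreeOneForm_iff _).2 ⟨_, rfl⟩,
      (σ.isSelfadjoint_slashed_iff _).2 hF.eq_neg_swap_star,
      (TwistedSM.HasFields.isUnimodular_slashed_iff σ hF).2 rfl⟩, _, rfl, hF⟩, ?_⟩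
    rintro T ⟨-, A, rfl, hA⟩
    rw [TwistedSM.HasFields.unique_left hA hF]
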